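/- All rings are commutative with 1, and no Noetherian assumption is made. An ideal is *regular* if it contains a nonzerodivisor; it is *stable* if it is projective as a module over its ring of endomorphisms. A ring is *stable* (resp. *finitely stable*) if each of its regular (resp. finitely generated regular) ideals is stable. An extension of rings $R\subseteq S$ is *quadratic* if $xy\in xR+yR+R$ for all $x,y\in S$. Let $Q(R)$ be the total ring of quotients of $R$ and $\overline R$ the integral closure of $R$ in $Q(R)$. A *Dedekind ring* is a ring in which every regular ideal is invertible. For a local ring $R$ (i.e. a ring with a unique maximal ideal) whose maximal ideal is regular put $R_0=R$, $R_{i+1}=\{q\in Q(R): q\,\mathrm{Jac}(R_i)\subseteq \mathrm{Jac}(R_i)\}$ for $i\ge 0$, and $R_\infty=\bigcup_i R_i$, where $\mathrm{Jac}$ denotes the Jacobson radical; $R$ is a *quadratic ring* if its maximal ideal is stable and $R\subseteq R_\infty$ is a quadratic extension. **Theorem.** Let $R$ be a local ring of Krull dimension one with regular maximal ideal $M$, let $m\in M$ be a nonzerodivisor, and let $J=\bigcap_{i>0}m^iR$. Then the following are equivalent: 1. $R$ is a stable ring; 2. $R$ is a finitely stable ring and its maximal ideal $M$ is stable; 3.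 $R$ is a quadratic ring and $\overline R$ has at most two maximal ideals; 4. $R\subseteq\overline R$ is a quadratic extension and $\overline R$ is a Dedekind ring with at most two maximal ideals; 5. $R/J$ is a stable ring. -/

import Mathlib

/-- An ideal is regular if it contains a nonzerodivisor. -/
def IsRegularIdeal {R : Type*} [CommRing R] (I : Ideal R) : Prop :=
  ∃ x ∈ I, x ∈ nonZeroDivisors R

/-- An ideal is stable if it is projective as a module over its ring of endomorphisms. -/
def IsStableIdeal {R : Type*} [CommRing R] (I : Ideal R) : Prop :=
  Module.Projective (Module.End R I) I

/-- A ring is stable if every regular ideal is stable. -/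
def IsStableRing (R : Type*) [CommRing R] : Prop :=
  ∀ I : Ideal R, IsRegularIdeal I → IsStableIdeal I

/-- A ring is finitely stable if every finitely generated regular ideal is stable. -/
def IsFinitelyStableRing (R : Type*) [CommRing R] : Prop :=
  ∀ I : Ideal R, I.FG → IsRegularIdeal I → IsStableIdeal I

/-- The extension `R ⊆ S` is quadratic if `x y ∈ x R + y R + R` for all `x, y ∈ S`. -/
def IsQuadraticExtension (R S : Type*) [CommRing R] [CommRing S] [Algebra R S] : Prop :=
  ∀ x y : S, ∃ a b c : R, x * y = a • x + b • y + algebraMap R S c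

/-- A Dedekind ring (zero divisors allowed): every regular ideal is invertible, that is, a unit in
the monoid of fractional ideals in the total ring of quotients. -/
def IsDedekindRegular (A : Type*) [CommRing A] : Prop :=
  ∀ I : Ideal A, IsRegularIdeal I →
    IsUnit (I : FractionalIdeal (nonZeroDivisors A) (FractionRing A))

/-- The ring `A` has at most two maximal ideals. -/
def HasAtMostTwoMaximalIdeals (A : Type*) [CommRing A] : Prop :=
  {N : Ideal A | N.IsMaximal}.encard ≤ 2

/-- The ring `E(N) = {q ∈ Q : q N ⊆ N}`. -/
def multiplierRing {R Q : Type*} [CommRing R] [CommRing Q] [Algebra R Q]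
    (N : Submodule R Q) : Subalgebra R Q where
  carrier := {q | ∀ x ∈ N, q * x ∈ N}
  mul_mem' := fun {a b} ha hb x hx => by
    rw [mul_assoc]
    exact ha _ (hb x hx)
  add_mem' := fun {a b} ha hb x hx => by
    rw [add_mul]
    exact N.add_mem (ha x hx) (hb x hx)
  algebraMap_mem' := fun r x hx => by
    rw [← Algebra.smul_def]
    exact N.smul_mem r hx

/-- The Jacobson radical of a ring `A` with `R ⊆ A ⊆ Q`, as a subset of `Q`. -/
def jacobsonRadicalIn {R Q : Type*} [CommRing R] [CommRing Q] [Algebra R Q]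
    (A : Subalgebra R Q) : Submodule R Q :=
  ((Ideal.jacobson (⊥ : Ideal A)).restrictScalars R).map A.val.toLinearMap

/-- The tower `R₀ = R`, `Rᵢ₊₁ = E(Jac Rᵢ)` of rings in `Q`. -/
def jacobsonTower (R Q : Type*) [CommRing R] [CommRing Q] [Algebra R Q] : ℕ → Subalgebra R Q
  | 0 => ⊥
  | i + 1 => multiplierRing (jacobsonRadicalIn (jacobsonTower R Q i))

theorem jacobsonTower_le_succ (R Q : Type*) [CommRing R] [CommRing Q] [Algebra R Q] (i : ℕ) :
    jacobsonTower R Q i ≤ jacobsonTower R Q (i + 1) := by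
  rintro a ha x ⟨y, hy, rfl⟩
  exact ⟨⟨a, ha⟩ * y, Ideal.mul_mem_left _ _ hy, rfl⟩

/-- The ring `R_∞`, the union of the tower; see `coe_jacobsonTowerUnion`. -/
def jacobsonTowerUnion (R Q : Type*) [CommRing R] [CommRing Q] [Algebra R Q] : Subalgebra R Q :=
  ⨆ i : ℕ, jacobsonTower R Q i

theorem coe_jacobsonTowerUnion (R Q : Type*) [CommRing R] [CommRing Q] [Algebra R Q] :
    (jacobsonTowerUnion R Q : Set Q) = ⋃ i : ℕ, (jacobsonTower R Q i : Set Q) :=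
  Subalgebra.coe_iSup_of_directed
    (monotone_nat_of_le_succ (jacobsonTower_le_succ R Q)).directed_le

/-- A quadratic ring: a local ring whose maximal ideal is stable and regular, and for which
`R ⊆ R_∞` is a quadratic extension, where `R_∞` is formed in the total ring of quotients of `R`. -/
def IsQuadraticRing (R : Type*) [CommRing R] : Prop :=
  ∃ _ : IsLocalRing R,
    IsQuadraticExtension R (jacobsonTowerUnion R (FractionRing R)) ∧
    IsStableIdeal (IsLocalRing.maximalIdeal R) ∧
    IsRegularIdeal (IsLocalRing.maximalIdeal R)

/-! For a regular ideal I the endomorphism ring is E = (I : I) inside Q(R), and I is projective over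
E exactly when it is invertible there, i.e. when 1 ∈ I·(I : I²). `quadraticColon` expresses this
without fractions: s ∈ I·{b : bI² ⊆ sI} for some nonzerodivisor s. In Q(R) the condition reads `1 ∈
V * (V / (V * V))`.

From 2 to 3, the condition is applied to well-chosen finitely generated V. For V = (1, x, y) with x,
y integral it cancels powers down to V² = V, so R ⊆ R̄ is quadratic. Three maximal ideals of R̄
would force the residue field 𝔽₂, and then a V with image spanned by (1,1,0) and (1,0,1) violates
the condition. V = (1, q) shows that the tower stays inside R̄.

From 3 to 4, a quadratic extension A satisfies Jac(A)² ⊆ MA, and stability of M gives x with M ⊆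
xR₁. Together with the construction of the tower this makes Jac(R_∞) principal, generated by a
nonzerodivisor. With at most two maximal ideals R_∞ is then Dedekind, hence integrally closed, hence
equal to R̄.

From 4 to 1, IR̄ is invertible over a ring with at most two maximal ideals, so it is generated by
some u ∈ I, and the quadratic relation turns into I² = uI.

For 1 and 5, dimension one lets s be a power of m. Since J = mⁿJ lies in every regular ideal, the
criterion passes between R and R/J. -/

open IsLocalRing

/-! ### A fraction-free criterion for stability -/

/-- The ideal of all `b` with `b I² ⊆ s I`. -/
def quadraticColon {R : Type*} [CommRing R] (s : R) (I : Ideal R) : Ideal R where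
  carrier := {b | ∀ x ∈ I, ∀ y ∈ I, ∃ w ∈ I, b * x * y = s * w}
  zero_mem' := fun x _ y _ => ⟨0, I.zero_mem, by ring⟩
  add_mem' := fun {a b} ha hb x hx y hy => by
    obtain ⟨v, hv, hv'⟩ := ha x hx y hy
    obtain ⟨w, hw, hw'⟩ := hb x hx y hy
    exact ⟨v + w, I.add_mem hv hw, by rw [mul_add, ← hv', ← hw']; ring⟩
  smul_mem' := fun c b hb x hx y hy => by
    obtain ⟨w, hw, hw'⟩ := hb x hx y hy
    exact ⟨c * w, I.mul_mem_left _ hw, by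
      rw [smul_eq_mul, mul_left_comm, ← hw']; ring⟩

theorem Ideal.end_apply_mul {R : Type*} [CommRing R] {I : Ideal R} (g : Module.End R I)
    (x y : I) : (g x : R) * y = x * g y := by
  have h : (y : R) • x = (x : R) • y := Subtype.ext (mul_comm _ _)
  have h' := congrArg (fun t => (g t : R)) h
  simp only [map_smul, Submodule.coe_smul, smul_eq_mul] at h'
  rw [mul_comm, h']

/-- A section `f` of the canonical surjection from the free module is a dual basis. Endomorphisms
act like multiplication by fractions, so z = ∑ f(z)(p)(p) becomes z² = ∑ p · f(z)(p)(z), and `key`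
puts each second factor into the colon for s = z². -/
theorem IsStableIdeal.exists_mem_mul_quadraticColon {R : Type*} [CommRing R] {I : Ideal R}
    (h : IsStableIdeal I) (hI : IsRegularIdeal I) :
    ∃ s ∈ nonZeroDivisors R, s ∈ I * quadraticColon s I := by
  obtain ⟨z, hz, hz'⟩ := hI
  obtain ⟨f, hf⟩ := Module.projective_def'.1 h
  set z₀ : I := ⟨z, hz⟩
  have hlin : ∀ (r : R) (x : I) (p : I), f (r • x) p = r • f x p := by
    intro r x p
    have h1 : r • x = (algebraMap R (Module.End R I) r) • x := by simp
    rw [h1, map_smul, Finsupp.smul_apply, smul_eq_mul, ← Algebra.smul_def]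
  have key : ∀ p x y : I, z * z * (f x p y : R) = x * y * f z₀ p z₀ := by
    intro p x y
    have h1 : z • x = (x : R) • z₀ := Subtype.ext (mul_comm _ _)
    have h2 := congrArg (fun t => (f t p y : R)) h1
    simp only [hlin, LinearMap.smul_apply, Submodule.coe_smul, smul_eq_mul] at h2
    have h3 := Ideal.end_apply_mul (f z₀ p) y z₀
    change _ * z = _ at h3
    rw [mul_assoc, h2]
    linear_combination (x : R) * h3
  refine ⟨z * z, mul_mem hz' hz', ?_⟩
  have hsum : (z₀ : I) = (f z₀).sum fun p g => g p := by
    have := LinearMap.congr_fun hf z₀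
    simpa [Finsupp.linearCombination_apply] using this.symm
  have h4 : z * z = ∑ p ∈ (f z₀).support, (p : R) * (f z₀ p z₀ : R) := by
    have h5 : z = ∑ p ∈ (f z₀).support, (f z₀ p p : R) := by
      have := congrArg (Subtype.val) hsum
      rw [Finsupp.sum, AddSubmonoidClass.coe_finsetSum] at this
      exact this
    conv_lhs => rw [h5, Finset.sum_mul, ← h5]
    exact Finset.sum_congr rfl fun p _ => Ideal.end_apply_mul (f z₀ p) p z₀
  suffices h5 : ∑ p ∈ (f z₀).support, (p : R) * (f z₀ p z₀ : R) ∈ I * quadraticColon (z * z) I by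
    rwa [← h4] at h5
  refine Ideal.sum_mem _ fun p _ => Ideal.mul_mem_mul p.2 ?_
  intro x hx y hy
  refine ⟨f ⟨x, hx⟩ p ⟨y, hy⟩, Subtype.prop _, ?_⟩
  rw [key p ⟨x, hx⟩ ⟨y, hy⟩]
  ring

/-- Writing s = ∑ aᵢbᵢ, the maps x ↦ (y ↦ bᵢxy/s) are coordinate functionals for the generators aᵢ,
because ∑ aᵢbᵢx/s = x. -/
theorem isStableIdeal_of_mem_mul_quadraticColon {R : Type*} [CommRing R] {I : Ideal R} {s : R}
    (hs : s ∈ nonZeroDivisors R) (h : s ∈ I * quadraticColon s I) : IsStableIdeal I := by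
  have hcancel : ∀ a b : I, s * (a : R) = s * b → a = b := fun a b hab =>
    Subtype.ext ((mul_cancel_left_mem_nonZeroDivisors hs).1 hab)
  -- A general t allows induction over sums: the composite is multiplication by t/s, and t = s gives
  -- the splitting.
  have key : ∀ t ∈ I * quadraticColon s I, ∃ L : I →ₗ[Module.End R I] (I →₀ Module.End R I),
      ∀ x : I, s * (Finsupp.linearCombination (Module.End R I) id (L x) : I) = t * (x : R) := by
    intro t ht
    induction ht using Submodule.mul_induction_on' with
    | mem_mul_mem a ha b hb =>
      choose w hw hw' using fun x y : I => hb x x.2 y y.2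
      let φ : I →ₗ[Module.End R I] Module.End R I :=
        { toFun := fun x =>
            { toFun := fun y => ⟨w x y, hw x y⟩
              map_add' := fun y y' => hcancel _ _ (by
                simp only [Submodule.coe_add, mul_add, ← hw'])
              map_smul' := fun r y => hcancel _ _ (by
                simp only [Submodule.coe_smul, smul_eq_mul, RingHom.id_apply]
                rw [mul_left_comm, ← hw', ← hw']
                simp only [Submodule.coe_smul, smul_eq_mul]; ring) }
          map_add' := fun x x' => LinearMap.ext fun y => hcancel _ _ (by
            simp only [LinearMap.coe_mk, AddHom.coe_mk, LinearMap.add_apply, Submodule.coe_add,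
              mul_add, ← hw', add_mul])
          map_smul' := fun g x => LinearMap.ext fun y => hcancel _ _ (by
            simp only [LinearMap.coe_mk, AddHom.coe_mk, RingHom.id_apply, smul_eq_mul,
              Module.End.mul_apply, Module.End.smul_def, ← hw']
            have h1 : s • (⟨w x y, hw x y⟩ : I) = (b * y) • x := Subtype.ext (by
              simp only [Submodule.coe_smul, smul_eq_mul, ← hw']; ring)
            have h2 := congrArg (fun t => (g t : R)) h1
            simp only [map_smul, Submodule.coe_smul, smul_eq_mul] at h2
            rw [h2]; ring) }
      refine ⟨(Finsupp.lsingle (⟨a, ha⟩ : I)).comp φ, fun x => ?_⟩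
      have : (Finsupp.linearCombination (Module.End R I) (id : I → I))
          (((Finsupp.lsingle (⟨a, ha⟩ : I)).comp φ) x) = φ x ⟨a, ha⟩ := by
        simp
      rw [this]
      change s * w x ⟨a, ha⟩ = _
      rw [← hw']; ring
    | add t _ t' _ h1 h2 =>
      obtain ⟨L, hL⟩ := h1
      obtain ⟨L', hL'⟩ := h2
      exact ⟨L + L', fun x => by
        rw [LinearMap.add_apply, map_add, Submodule.coe_add, mul_add, hL, hL', add_mul]⟩
  obtain ⟨L, hL⟩ := key s h
  exact Module.projective_def'.2 ⟨L, LinearMap.ext fun x => hcancel _ _ (hL x)⟩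

theorem isStableIdeal_of_mul_le {R : Type*} [CommRing R] {I : Ideal R} {u : R}
    (hu : u ∈ nonZeroDivisors R) (huI : u ∈ I)
    (h : ∀ x ∈ I, ∀ y ∈ I, ∃ w ∈ I, x * y = u * w) : IsStableIdeal I := by
  refine isStableIdeal_of_mem_mul_quadraticColon hu ?_
  have h1 : (1 : R) ∈ quadraticColon u I := fun x hx y hy => by
    rw [one_mul]; exact h x hx y hy
  simpa using Ideal.mul_mem_mul huI h1

/-! ### Dimension one, and rings with at most two maximal ideals -/

theorem exists_dvd_pow_of_krullDimLE_one {R : Type*} [CommRing R] [IsLocalRing R]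
    [Ring.KrullDimLE 1 R] {m s : R} (hm : m ∈ maximalIdeal R) (hs : s ∈ nonZeroDivisors R) :
    ∃ n, s ∣ m ^ n := by
  -- A nonzerodivisor avoids the minimal primes, so the maximal ideal is the only prime that can
  -- contain s.
  have h : m ∈ (Ideal.span {s}).radical := by
    rw [Ideal.radical_eq_sInf, Ideal.mem_sInf]
    rintro P ⟨hP, hP'⟩
    rcases Ring.krullDimLE_one_iff.1 ‹_› P hP' with h | h
    · exact absurd hs (Set.disjoint_left.1 (Ideal.disjoint_nonZeroDivisors_of_mem_minimalPrimes h)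
        (hP (Ideal.mem_span_singleton_self s)))
    · rwa [eq_maximalIdeal h]
  obtain ⟨n, hn⟩ := h
  exact ⟨n, Ideal.mem_span_singleton.1 hn⟩

theorem isMaximal_of_mem_nonZeroDivisors {R : Type*} [CommRing R]
    [Ring.KrullDimLE 1 R] {m : R} (hm : m ∈ nonZeroDivisors R) {P : Ideal R}
    (hP : P.IsPrime) (hmP : m ∈ P) : P.IsMaximal :=
  (Ring.krullDimLE_one_iff.1 ‹_› P hP).resolve_left fun h =>
    Set.disjoint_left.1 (Ideal.disjoint_nonZeroDivisors_of_mem_minimalPrimes h) hmP hm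

theorem HasAtMostTwoMaximalIdeals.exists_pair {A : Type*} [CommRing A] [Nontrivial A]
    (h : HasAtMostTwoMaximalIdeals A) : ∃ N₁ N₂ : Ideal A, N₁.IsMaximal ∧ N₂.IsMaximal ∧
      ∀ N : Ideal A, N.IsMaximal → N = N₁ ∨ N = N₂ := by
  obtain ⟨N₁, h₁⟩ := Ideal.exists_maximal A
  by_cases h' : ∃ N₂ : Ideal A, N₂.IsMaximal ∧ N₂ ≠ N₁
  · obtain ⟨N₂, h₂, h₂₁⟩ := h'
    refine ⟨N₁, N₂, h₁, h₂, fun N hN => ?_⟩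
    by_contra! hc
    have h3 : ({N, N₁, N₂} : Set (Ideal A)) ⊆ {N | N.IsMaximal} := by
      rintro x (rfl | rfl | rfl) <;> assumption
    have h4 := (Set.encard_le_encard h3).trans h
    rw [Set.encard_eq_three.2 ⟨N, N₁, N₂, hc.1, hc.2, h₂₁.symm, rfl⟩] at h4
    exact absurd h4 (by decide)
  · push Not at h'
    exact ⟨N₁, N₁, h₁, h₁, fun N hN => Or.inl (h' N hN)⟩

/-- A group is not the union of two proper subgroups: if a works only at N₁ and b only at N₂, then a
+ b works at both. This replaces prime avoidance and needs no large residue field. -/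
theorem HasAtMostTwoMaximalIdeals.exists_eq_top {A G : Type*} [CommRing A] [Nontrivial A]
    [AddCommGroup G] (h : HasAtMostTwoMaximalIdeals A) (φ : G → Ideal A)
    (hsub : ∀ a b, φ (a - b) ≤ φ a ⊔ φ b)
    (hφ : ∀ N : Ideal A, N.IsMaximal → ∃ a, ¬ φ a ≤ N) : ∃ a, φ a = ⊤ := by
  obtain ⟨N₁, N₂, h₁, h₂, hN⟩ := h.exists_pair
  suffices h' : ∃ a, ¬ φ a ≤ N₁ ∧ ¬ φ a ≤ N₂ by
    obtain ⟨a, ha₁, ha₂⟩ := h'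
    refine ⟨a, by_contra fun ha => ?_⟩
    obtain ⟨N, hN', haN⟩ := Ideal.exists_le_maximal _ ha
    rcases hN N hN' with rfl | rfl
    exacts [ha₁ haN, ha₂ haN]
  obtain ⟨a, ha⟩ := hφ N₁ h₁
  obtain ⟨b, hb⟩ := hφ N₂ h₂
  by_cases ha₂ : φ a ≤ N₂
  · by_cases hb₁ : φ b ≤ N₁
    · refine ⟨a + b, fun hc => ha ?_, fun hc => hb ?_⟩
      · simpa using (hsub (a + b) b).trans (sup_le hc hb₁)
      · simpa using (hsub (a + b) a).trans (sup_le hc ha₂)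
    · exact ⟨b, hb₁, hb⟩
  · exact ⟨a, ha, ha₂⟩

theorem hasAtMostTwoMaximalIdeals_of_forall {A : Type*} [CommRing A]
    (h : ∀ N₁ N₂ N₃ : Ideal A, N₁.IsMaximal → N₂.IsMaximal → N₃.IsMaximal →
      N₁ ≠ N₂ → N₁ ≠ N₃ → N₂ ≠ N₃ → False) : HasAtMostTwoMaximalIdeals A := by
  by_contra hc
  unfold HasAtMostTwoMaximalIdeals at hc
  rw [not_le] at hc
  have h3 : (3 : ℕ∞) ≤ {N : Ideal A | N.IsMaximal}.encard := Order.add_one_le_of_lt hc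
  obtain ⟨t, ht, ht'⟩ := Set.exists_subset_encard_eq h3
  obtain ⟨x, y, z, hxy, hxz, hyz, rfl⟩ := Set.encard_eq_three.1 ht'
  exact h x y z (ht (by simp)) (ht (by simp)) (ht (by simp)) hxy hxz hyz

theorem HasAtMostTwoMaximalIdeals.of_isIntegral {A B : Type*} [CommRing A] [CommRing B]
    (f : A →+* B) (hf : f.IsIntegral) (hinj : Function.Injective f)
    (h : HasAtMostTwoMaximalIdeals B) : HasAtMostTwoMaximalIdeals A := by
  let := f.toAlgebra
  have : Algebra.IsIntegral A B := ⟨hf⟩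
  refine le_trans (le_trans (Set.encard_le_encard (t := Ideal.comap f '' {N | N.IsMaximal}) ?_)
    (Set.encard_image_le _ _)) h
  intro N (hN : N.IsMaximal)
  obtain ⟨P, hP, hP'⟩ := Ideal.exists_ideal_over_maximal_of_isIntegral (S := B) N (by
    rw [show RingHom.ker (algebraMap A B) = ⊥ from (RingHom.injective_iff_ker_eq_bot _).1 hinj]
    exact bot_le)
  exact ⟨P, hP, hP'⟩

theorem Submodule.FG.exists_le_of_monotone {R M : Type*} [Semiring R] [AddCommMonoid M]
    [Module R M] {N : Submodule R M} (hN : N.FG) {f : ℕ → Submodule R M} (hf : Monotone f)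
    (h : ∀ x ∈ N, ∃ n, x ∈ f n) : ∃ n, N ≤ f n := by
  obtain ⟨S, rfl⟩ := hN
  choose! g hg using h
  refine ⟨S.sup g, Submodule.span_le.2 fun x hx => ?_⟩
  exact hf (Finset.le_sup hx) (hg x (Submodule.subset_span hx))

theorem mem_nonZeroDivisors_of_isUnit_map {A B : Type*} [CommRing A] [CommRing B] {f : A →+* B}
    (hf : Function.Injective f) {x : A} (hx : IsUnit (f x)) : x ∈ nonZeroDivisors A := by
  rw [mem_nonZeroDivisors_iff_right]
  intro z hz
  have h := congrArg f hz
  rw [map_mul, map_zero, hx.mul_left_eq_zero] at h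
  exact hf (by rw [h, map_zero])

/-! ### The stability criterion inside the total ring of quotients -/

section Submodules

variable {R Q : Type*} [CommRing R] [CommRing Q] [Algebra R Q]

theorem mem_div_mul_iff {V : Submodule R Q} {b : Q} :
    b ∈ V / (V * V) ↔ ∀ x ∈ V, ∀ y ∈ V, b * (x * y) ∈ V := by
  rw [Submodule.mem_div_iff_forall_mul_mem]
  refine ⟨fun h x hx y hy => h _ (Submodule.mul_mem_mul hx hy), fun h t ht => ?_⟩
  induction ht using Submodule.mul_induction_on' with
  | mem_mul_mem a ha b hb => exact h _ ha _ hb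
  | add t _ t' _ h1 h2 => rw [mul_add]; exact V.add_mem h1 h2

theorem mul_mem_multiplierRing {V : Submodule R Q} {a b : Q} (ha : a ∈ V)
    (hb : b ∈ V / (V * V)) : a * b ∈ multiplierRing V := fun x hx => by
  rw [mul_right_comm, mul_comm]
  exact mem_div_mul_iff.1 hb a ha x hx

/-- Cayley–Hamilton for multiplication by e on V; the unit w ∈ V turns p(e)w = 0 into p(e) = 0. -/
theorem isIntegral_of_mem_multiplierRing {V : Submodule R Q} (hV : V.FG) {w : Q} (hw : w ∈ V)
    (hw' : IsUnit w) {e : Q} (he : e ∈ multiplierRing V) : IsIntegral R e := by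
  have := Module.Finite.iff_fg.2 hV
  let f : Module.End R V := (LinearMap.mulLeft R e).restrict he
  obtain ⟨p, hp, hp'⟩ := LinearMap.exists_monic_and_aeval_eq_zero R f
  refine ⟨p, hp, ?_⟩
  have h1 : ∀ q : Polynomial R, ∀ v : V, (Polynomial.aeval f q v : Q) = Polynomial.aeval e q * v := by
    intro q v
    induction q using Polynomial.induction_on' with
    | add p q hp hq => simp [hp, hq, add_mul]
    | monomial n a =>
      have h2 : ∀ n, ((f ^ n) v : Q) = e ^ n * v := fun n => by
        induction n with
        | zero => simp
        | succ n ih =>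
          rw [pow_succ', Module.End.mul_apply, pow_succ', mul_assoc, ← ih]; rfl
      simp [Polynomial.aeval_monomial, h2, Algebra.smul_def, mul_assoc]
  have h2 := h1 p ⟨w, hw⟩
  rw [hp'] at h2
  simpa [hw'.mul_left_eq_zero, Polynomial.aeval_def] using h2.symm

theorem IsStableIdeal.one_mem_mul_div [IsFractionRing R Q] {I : Ideal R} (h : IsStableIdeal I)
    (hI : IsRegularIdeal I) {r : R} (hr : r ∈ nonZeroDivisors R) {V : Submodule R Q}
    (h1 : ∀ v ∈ V, ∃ x ∈ I, algebraMap R Q x = algebraMap R Q r * v)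
    (h2 : ∀ x ∈ I, ∃ v ∈ V, algebraMap R Q x = algebraMap R Q r * v) :
    (1 : Q) ∈ V * (V / (V * V)) := by
  obtain ⟨s, hs, hs'⟩ := h.exists_mem_mul_quadraticColon hI
  obtain ⟨s', hs's⟩ := (IsLocalization.map_units Q ⟨s, hs⟩).exists_left_inv
  have hru := IsLocalization.map_units Q ⟨r, hr⟩
  simp only at hs's hru
  have key : ∀ t ∈ I * quadraticColon s I, s' * algebraMap R Q t ∈ V * (V / (V * V)) := by
    intro t ht
    induction ht using Submodule.mul_induction_on' with
    | mem_mul_mem a ha b hb =>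
      obtain ⟨v, hv, hv'⟩ := h2 a ha
      have : s' * algebraMap R Q (a * b) = v * (s' * algebraMap R Q (r * b)) := by
        rw [map_mul, hv', map_mul]; ring
      rw [this]
      refine Submodule.mul_mem_mul hv (mem_div_mul_iff.2 fun x hx y hy => ?_)
      obtain ⟨x', hx', hx''⟩ := h1 x hx
      obtain ⟨y', hy', hy''⟩ := h1 y hy
      obtain ⟨w, hw, hw'⟩ := hb x' hx' y' hy'
      obtain ⟨u, hu, hu'⟩ := h2 w hw
      convert hu using 1
      refine hru.mul_left_cancel ?_
      have h3 := congrArg (algebraMap R Q) hw'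
      simp only [map_mul, hx'', hy'', hu'] at h3 ⊢
      linear_combination s' * h3 + algebraMap R Q r * u * hs's
    | add t _ t' _ h1 h2 => rw [map_add, mul_add]; exact Submodule.add_mem _ h1 h2
  simpa [hs's] using key s hs'

theorem IsFinitelyStableRing.one_mem_mul_div [IsFractionRing R Q] (h : IsFinitelyStableRing R)
    {V : Submodule R Q} (hV : V.FG) {w : Q} (hw : w ∈ V) (hw' : IsUnit w) :
    (1 : Q) ∈ V * (V / (V * V)) := by
  obtain ⟨r, hr, hrV⟩ := FractionalIdeal.isFractional_of_fg (S := nonZeroDivisors R) hV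
  have hru := IsLocalization.map_units Q ⟨r, hr⟩
  have hinj : Function.Injective (Algebra.linearMap R Q) := IsFractionRing.injective R Q
  let I : Ideal R := (V.map (LinearMap.mulLeft R (algebraMap R Q r))).comap (Algebra.linearMap R Q)
  have h1 : ∀ v ∈ V, ∃ x ∈ I, algebraMap R Q x = algebraMap R Q r * v := fun v hv => by
    obtain ⟨x, hx⟩ := hrV v hv
    rw [Algebra.smul_def] at hx
    exact ⟨x, ⟨v, hv, hx.symm⟩, hx⟩
  have h2 : ∀ x ∈ I, ∃ v ∈ V, algebraMap R Q x = algebraMap R Q r * v := by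
    rintro x ⟨v, hv, hx⟩
    exact ⟨v, hv, hx.symm⟩
  have hreg : IsRegularIdeal I := by
    obtain ⟨x, hx, hx'⟩ := h1 w hw
    exact ⟨x, hx, mem_nonZeroDivisors_of_isUnit_map (IsFractionRing.injective R Q)
      (hx' ▸ hru.mul hw')⟩
  have hfg : I.FG := by
    refine Submodule.fg_of_fg_map_injective _ hinj ?_
    rw [Submodule.map_comap_eq_of_le]
    · exact hV.map _
    · rintro _ ⟨v, hv, rfl⟩
      obtain ⟨x, -, hx⟩ := h1 v hv
      exact ⟨x, hx⟩
  exact (h I hfg hreg).one_mem_mul_div hreg hr h1 h2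

end Submodules

theorem Ideal.mem_jacobson_bot_iff_forall {A : Type*} [CommRing A] {x : A} :
    x ∈ Ideal.jacobson (⊥ : Ideal A) ↔ ∀ N : Ideal A, N.IsMaximal → x ∈ N := by
  simp [Ideal.jacobson, Submodule.mem_sInf]

/-! ### Integral overrings of R in Q -/

section Overrings

variable {R Q : Type*} [CommRing R] [CommRing Q] [Algebra R Q] {A B : Subalgebra R Q}

theorem Subalgebra.algebra_isIntegral_of_le (hA : A ≤ integralClosure R Q) :
    Algebra.IsIntegral R A :=
  ⟨fun x => (isIntegral_algHom_iff A.val Subtype.val_injective).1 (hA x.2)⟩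

theorem Subalgebra.inclusion_isIntegral (hB : B ≤ integralClosure R Q) (h : A ≤ B) :
    (Subalgebra.inclusion h : A →+* B).IsIntegral := by
  have := Subalgebra.algebra_isIntegral_of_le hB
  intro x
  obtain ⟨p, hp, hp'⟩ := Algebra.IsIntegral.isIntegral (R := R) x
  refine ⟨p.map (algebraMap R A), hp.map _, ?_⟩
  rw [Polynomial.eval₂_map]
  exact hp'

theorem Subalgebra.isMaximal_comap_inclusion (hB : B ≤ integralClosure R Q) (h : A ≤ B)
    {N : Ideal B} (hN : N.IsMaximal) :
    (N.comap (Subalgebra.inclusion h : A →+* B)).IsMaximal :=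
  Ideal.isMaximal_comap_of_isIntegral_of_isMaximal' _ (Subalgebra.inclusion_isIntegral hB h) N

theorem Subalgebra.exists_isMaximal_comap_inclusion (hB : B ≤ integralClosure R Q) (h : A ≤ B)
    {N : Ideal A} (hN : N.IsMaximal) : ∃ P : Ideal B, P.IsMaximal ∧
      P.comap (Subalgebra.inclusion h : A →+* B) = N := by
  let := (Subalgebra.inclusion h : A →+* B).toAlgebra
  have : Algebra.IsIntegral A B := ⟨Subalgebra.inclusion_isIntegral hB h⟩
  refine Ideal.exists_ideal_over_maximal_of_isIntegral (S := B) N ?_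
  rw [show RingHom.ker (algebraMap A B) = ⊥ from
    (RingHom.injective_iff_ker_eq_bot _).1 (Subalgebra.inclusion_injective h)]
  exact bot_le

theorem Subalgebra.mem_jacobson_inclusion_iff (hB : B ≤ integralClosure R Q) (h : A ≤ B) (x : A) :
    Subalgebra.inclusion h x ∈ Ideal.jacobson (⊥ : Ideal B) ↔
      x ∈ Ideal.jacobson (⊥ : Ideal A) := by
  simp only [Ideal.mem_jacobson_bot_iff_forall]
  refine ⟨fun hx N hN => ?_, fun hx N hN => hx _ (Subalgebra.isMaximal_comap_inclusion hB h hN)⟩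
  obtain ⟨P, hP, rfl⟩ := Subalgebra.exists_isMaximal_comap_inclusion hB h hN
  exact hx P hP

theorem HasAtMostTwoMaximalIdeals.of_le (hB : B ≤ integralClosure R Q) (h : A ≤ B)
    (h2 : HasAtMostTwoMaximalIdeals B) : HasAtMostTwoMaximalIdeals A :=
  h2.of_isIntegral _ (Subalgebra.inclusion_isIntegral hB h) (Subalgebra.inclusion_injective h)

theorem Subalgebra.algebraMap_mem_maximal_iff [IsLocalRing R] (hA : A ≤ integralClosure R Q)
    {N : Ideal A} (hN : N.IsMaximal) {r : R} : algebraMap R A r ∈ N ↔ r ∈ maximalIdeal R := by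
  have := Subalgebra.algebra_isIntegral_of_le hA
  have h := Ideal.isMaximal_comap_of_isIntegral_of_isMaximal (R := R) N
  rw [← eq_maximalIdeal h, Ideal.mem_comap]

theorem Subalgebra.isMaximal_of_isPrime [Ring.KrullDimLE 1 R]
    (hA : A ≤ integralClosure R Q) {m : R} (hm : m ∈ nonZeroDivisors R) {P : Ideal A}
    (hP : P.IsPrime) (hmP : algebraMap R A m ∈ P) : P.IsMaximal := by
  have := Subalgebra.algebra_isIntegral_of_le hA
  exact Ideal.isMaximal_of_isIntegral_of_isMaximal_comap (R := R) P
    (isMaximal_of_mem_nonZeroDivisors hm (hP.comap _) hmP)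

theorem Subalgebra.isUnit_of_mem_nonZeroDivisors [IsFractionRing R Q] {p : A}
    (hp : p ∈ nonZeroDivisors A) : IsUnit (p : Q) := by
  obtain ⟨⟨a, s⟩, hs⟩ := IsLocalization.surj (nonZeroDivisors R) (p : Q)
  have hsu := IsLocalization.map_units Q s
  have hs' : (algebraMap R A s : A) ∈ nonZeroDivisors A :=
    mem_nonZeroDivisors_of_isUnit_map (f := (A.val : A →+* Q)) Subtype.val_injective hsu
  have h1 : p * algebraMap R A s = algebraMap R A a := Subtype.ext hs
  have h2 : algebraMap R A a ∈ nonZeroDivisors A := h1 ▸ mul_mem hp hs'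
  have hinj : Function.Injective (algebraMap R A) := fun x y hxy =>
    IsFractionRing.injective R Q (congrArg Subtype.val hxy)
  have h3 : a ∈ nonZeroDivisors R := mem_nonZeroDivisors_iff_right.2 fun z hz =>
    hinj (by
      rw [map_zero]
      exact (mem_nonZeroDivisors_iff_right.1 h2) _ (by rw [← map_mul, hz, map_zero]))
  have h4 : IsUnit (p * algebraMap R Q s : Q) := hs ▸ IsLocalization.map_units Q ⟨a, h3⟩
  exact isUnit_of_mul_isUnit_left h4

theorem Subalgebra.mem_nonZeroDivisors_of_isUnit {p : A} (hp : IsUnit (p : Q)) :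
    p ∈ nonZeroDivisors A :=
  mem_nonZeroDivisors_of_isUnit_map (f := (A.val : A →+* Q)) Subtype.val_injective hp

theorem IsQuadraticExtension.le_integralClosure (h : IsQuadraticExtension R A) :
    A ≤ integralClosure R Q := by
  intro x hx
  obtain ⟨a, b, c, habc⟩ := h ⟨x, hx⟩ ⟨x, hx⟩
  have h1 : x * x = algebraMap R Q a * x + algebraMap R Q b * x + algebraMap R Q c := by
    have := congrArg Subtype.val habc
    simpa [Algebra.smul_def] using this
  refine ⟨Polynomial.X ^ 2 - (Polynomial.C (a + b) * Polynomial.X + Polynomial.C c),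
    Polynomial.monic_X_pow_sub (by
      rw [show ((2 : ℕ) : WithBot ℕ) = ((1 : ℕ) : WithBot ℕ) + 1 by norm_num]
      exact lt_of_le_of_lt (by compute_degree) (by norm_num)), ?_⟩
  simp only [Polynomial.eval₂_sub, Polynomial.eval₂_pow, Polynomial.eval₂_X, Polynomial.eval₂_add,
    Polynomial.eval₂_mul, Polynomial.eval₂_C, map_add]
  linear_combination h1

theorem IsQuadraticExtension.of_le (h : IsQuadraticExtension R B) (hAB : A ≤ B) :
    IsQuadraticExtension R A := fun x y => by
  obtain ⟨a, b, c, habc⟩ := h (Subalgebra.inclusion hAB x) (Subalgebra.inclusion hAB y)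
  exact ⟨a, b, c, Subalgebra.inclusion_injective hAB (by simpa using habc)⟩

/-- With V = (1, x, y) and C = (V : V²), stability gives V²C = V. The powers of V stabilise because
R[x, y] is a finite module, and cancelling with C brings this down to V² = V. -/
theorem IsFinitelyStableRing.isQuadraticExtension_integralClosure [IsFractionRing R Q]
    (h : IsFinitelyStableRing R) : IsQuadraticExtension R (integralClosure R Q) := by
  intro x y
  set V : Submodule R Q := Submodule.span R {1, (x : Q), (y : Q)} with hVdef
  have h1V : (1 : Q) ∈ V := Submodule.subset_span (by simp)
  have hxV : (x : Q) ∈ V := Submodule.subset_span (by simp)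
  have hyV : (y : Q) ∈ V := Submodule.subset_span (by simp)
  have hV := h.one_mem_mul_div (Submodule.fg_span (by simp)) h1V isUnit_one
  set C := V / (V * V) with hC
  have hCV : V * V * C ≤ V := by
    rw [mul_comm]; exact Submodule.mul_le.2 fun a ha b hb =>
      Submodule.mem_div_iff_forall_mul_mem.1 ha b hb
  have h1le : (1 : Submodule R Q) ≤ V := Submodule.one_le.2 h1V
  have hmono : Monotone fun n => V ^ n := monotone_nat_of_le_succ fun n => by
    rw [pow_succ]
    exact (mul_one (V ^ n)).symm.le.trans (mul_le_mul' le_rfl h1le)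
  obtain ⟨n, hn⟩ : ∃ n, Subalgebra.toSubmodule (Algebra.adjoin R {(x : Q), (y : Q)}) ≤ V ^ n := by
    refine Submodule.FG.exists_le_of_monotone ?_ hmono ?_
    · refine fg_adjoin_of_finite (by simp) ?_
      rintro z (rfl | rfl)
      exacts [x.2, y.2]
    · intro z hz
      rw [Subalgebra.mem_toSubmodule] at hz
      induction hz using Algebra.adjoin_induction with
      | mem z hz => exact ⟨1, by rcases hz with rfl | rfl <;> simpa⟩
      | algebraMap r => exact ⟨0, by rw [pow_zero]; exact Submodule.algebraMap_mem r⟩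
      | add a b _ _ ha hb =>
        obtain ⟨i, hi⟩ := ha
        obtain ⟨j, hj⟩ := hb
        exact ⟨max i j, Submodule.add_mem _ (hmono (le_max_left i j) hi)
          (hmono (le_max_right i j) hj)⟩
      | mul a b _ _ ha hb =>
        obtain ⟨i, hi⟩ := ha
        obtain ⟨j, hj⟩ := hb
        exact ⟨i + j, by rw [pow_add]; exact Submodule.mul_mem_mul hi hj⟩
  have hVn : V ^ (n + 1) = V ^ n := by
    refine le_antisymm (le_trans ?_ hn) (hmono n.le_succ)
    have : V ≤ Subalgebra.toSubmodule (Algebra.adjoin R {(x : Q), (y : Q)}) := by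
      refine Submodule.span_le.2 ?_
      rintro z (rfl | rfl | rfl)
      exacts [Subalgebra.one_mem _, Algebra.subset_adjoin (by simp), Algebra.subset_adjoin (by simp)]
    induction n + 1 with
    | zero => rw [pow_zero]; exact Submodule.one_le.2 (Subalgebra.one_mem _)
    | succ k ih =>
      rw [pow_succ]
      exact Submodule.mul_le.2 fun a ha b hb => Subalgebra.mul_mem _ (ih ha) (this hb)
  have hcancel : V * (V * C) = V := le_antisymm (by rw [← mul_assoc]; exact hCV) (by
    conv_lhs => rw [← mul_one V]
    exact mul_le_mul' le_rfl (Submodule.one_le.2 hV))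
  -- Multiplication by C removes one factor V from each side.
  have hdesc : ∀ k, V ^ (k + 2) = V ^ (k + 1) → V * V = V := by
    intro k
    induction k with
    | zero => intro hk; simpa [pow_two] using hk
    | succ k ih =>
      intro hk
      apply ih
      calc V ^ (k + 2) = V ^ (k + 1) * (V * (V * C)) := by rw [hcancel, pow_succ]
        _ = V ^ (k + 3) * C := by ring
        _ = V ^ (k + 2) * C := by rw [hk]
        _ = V ^ k * (V * (V * C)) := by ring
        _ = V ^ (k + 1) := by rw [hcancel, pow_succ]
  have hVV : V * V = V := hdesc n (by rw [pow_succ, hVn, ← pow_succ, hVn])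
  have hxy : (x * y : Q) ∈ V := hVV ▸ Submodule.mul_mem_mul hxV hyV
  obtain ⟨c, z, hz, hz'⟩ := Submodule.mem_span_insert.1 hxy
  obtain ⟨a, b, rfl⟩ := Submodule.mem_span_pair.1 hz
  refine ⟨a, b, c, Subtype.ext ?_⟩
  simp only [MulMemClass.coe_mul, hz', AddMemClass.coe_add, Subalgebra.coe_smul,
    Algebra.algebraMap_eq_smul_one, OneMemClass.coe_one]
  abel

end Overrings

/-! ### At most two maximal ideals over a finitely stable local ring -/

theorem Ideal.exists_sub_one_mem_and_mem {A : Type*} [CommRing A] {N₁ N₂ N₃ : Ideal A}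
    (h₁ : N₁.IsMaximal) (h₂ : N₂.IsMaximal) (h₃ : N₃.IsMaximal) (h12 : N₁ ≠ N₂) (h13 : N₁ ≠ N₃) :
    ∃ e, e - 1 ∈ N₁ ∧ e ∈ N₂ ∧ e ∈ N₃ := by
  have h2 := (Ideal.eq_top_iff_one _).1 (h₁.coprime_of_ne h₂ h12)
  have h3 := (Ideal.eq_top_iff_one _).1 (h₁.coprime_of_ne h₃ h13)
  obtain ⟨a, ha, b, hb, hab⟩ := Submodule.mem_sup.1 h2
  obtain ⟨c, hc, d, hd, hcd⟩ := Submodule.mem_sup.1 h3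
  refine ⟨b * d, ?_, N₂.mul_mem_right _ hb, N₃.mul_mem_left _ hd⟩
  rw [show b * d - 1 = -(d * a) - c by linear_combination d * hab + hcd]
  exact N₁.sub_mem (N₁.neg_mem (N₁.mul_mem_left _ ha)) hc

section Overrings

variable {R Q : Type*} [CommRing R] [CommRing Q] [Algebra R Q] {A : Subalgebra R Q}

/-- An element with residues (1, t, 0) is a root of a monic quadratic X² - (a + b)X - c over R. The
residue 0 gives c ≡ 0, the residue 1 then gives a + b ≡ 1, so t² ≡ t. Thus the residue field is 𝔽₂.
-/
theorem IsQuadraticExtension.mem_or_sub_one_mem [IsLocalRing R] (h : IsQuadraticExtension R A)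
    {N₁ N₂ N₃ : Ideal A} (h₁ : N₁.IsMaximal) (h₂ : N₂.IsMaximal) (h₃ : N₃.IsMaximal)
    (h12 : N₁ ≠ N₂) (h13 : N₁ ≠ N₃) (h23 : N₂ ≠ N₃) (t : R) :
    t ∈ maximalIdeal R ∨ t - 1 ∈ maximalIdeal R := by
  have hA := h.le_integralClosure
  obtain ⟨e, he1, he2, he3⟩ := Ideal.exists_sub_one_mem_and_mem h₁ h₂ h₃ h12 h13
  obtain ⟨f, hf2, hf1, hf3⟩ := Ideal.exists_sub_one_mem_and_mem h₂ h₁ h₃ h12.symm h23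
  set s : A := algebraMap R A t
  set x : A := e + s * f with hx
  obtain ⟨a, b, c, habc⟩ := h x x
  simp only [Algebra.smul_def] at habc
  set a' := algebraMap R A a
  set b' := algebraMap R A b
  set c' := algebraMap R A c with hc'
  have hx3 : x ∈ N₃ := N₃.add_mem he3 (N₃.mul_mem_left _ hf3)
  have hx1 : x - 1 ∈ N₁ := by
    rw [show x - 1 = (e - 1) + s * f by ring]
    exact N₁.add_mem he1 (N₁.mul_mem_left _ hf1)
  have hx2 : x - s ∈ N₂ := by
    rw [show x - s = e + s * (f - 1) by ring]
    exact N₂.add_mem he2 (N₂.mul_mem_left _ hf2)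
  have hc3 : c' ∈ N₃ := by
    rw [show c' = x * (x - a' - b') by linear_combination -habc]
    exact N₃.mul_mem_right _ hx3
  have hc : c ∈ maximalIdeal R := (Subalgebra.algebraMap_mem_maximal_iff hA h₃).1 hc3
  have h4 : algebraMap R A (a + b - 1) ∈ N₁ := by
    have : algebraMap R A (a + b - 1) = (x - 1) * (x + 1 - a' - b') - c' := by
      simp only [map_sub, map_add, map_one]; linear_combination -habc
    rw [this]
    exact N₁.sub_mem (N₁.mul_mem_right _ hx1) ((Subalgebra.algebraMap_mem_maximal_iff hA h₁).2 hc)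
  have h5 : algebraMap R A (t * t - (a + b) * t) ∈ N₂ := by
    have : algebraMap R A (t * t - (a + b) * t) = c' - (x - s) * (x + s - a' - b') := by
      simp only [map_sub, map_add, map_mul]; linear_combination habc
    rw [this]
    exact N₂.sub_mem ((Subalgebra.algebraMap_mem_maximal_iff hA h₂).2 hc) (N₂.mul_mem_right _ hx2)
  rw [Subalgebra.algebraMap_mem_maximal_iff hA h₁] at h4
  rw [Subalgebra.algebraMap_mem_maximal_iff hA h₂] at h5
  rw [← (maximalIdeal.isMaximal R).isPrime.mul_mem_iff_mem_or_mem]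
  rw [show t * (t - 1) = (t * t - (a + b) * t) + t * (a + b - 1) by ring]
  exact Ideal.add_mem _ h5 (Ideal.mul_mem_left _ _ h4)

theorem IsFinitelyStableRing.hasAtMostTwoMaximalIdeals [IsFractionRing R Q] [IsLocalRing R]
    (h : IsFinitelyStableRing R) {m : R} (hm : m ∈ maximalIdeal R) (hreg : m ∈ nonZeroDivisors R) :
    HasAtMostTwoMaximalIdeals (integralClosure R Q) := by
  set A := integralClosure R Q
  refine hasAtMostTwoMaximalIdeals_of_forall fun N₁ N₂ N₃ h₁ h₂ h₃ h12 h13 h23 => ?_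
  have hmem : ∀ {N : Ideal A}, N.IsMaximal → ∀ {r : R}, algebraMap R A r ∈ N ↔
    r ∈ maximalIdeal R := fun hN r => Subalgebra.algebraMap_mem_maximal_iff le_rfl hN
  have hk := (h.isQuadraticExtension_integralClosure (Q := Q)).mem_or_sub_one_mem
    h₁ h₂ h₃ h12 h13 h23
  obtain ⟨e, he1, he2, he3⟩ := Ideal.exists_sub_one_mem_and_mem h₁ h₂ h₃ h12 h13
  obtain ⟨f, hf2, hf1, hf3⟩ := Ideal.exists_sub_one_mem_and_mem h₂ h₁ h₃ h12.symm h23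
  obtain ⟨g, hg3, hg1, hg2⟩ := Ideal.exists_sub_one_mem_and_mem h₃ h₁ h₂ h13.symm h23.symm
  -- the images of `x` and `y` in the product of the residue fields are `(1,1,0)` and `(1,0,1)`
  set x : A := e + f
  set y : A := e + g
  have hx1 : x - 1 ∈ N₁ := by
    rw [show x - 1 = (e - 1) + f by ring]; exact N₁.add_mem he1 hf1
  have hx2 : x - 1 ∈ N₂ := by
    rw [show x - 1 = e + (f - 1) by ring]; exact N₂.add_mem he2 hf2
  have hx3 : x ∈ N₃ := N₃.add_mem he3 hf3
  have hy1 : y - 1 ∈ N₁ := by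
    rw [show y - 1 = (e - 1) + g by ring]; exact N₁.add_mem he1 hg1
  have hy2 : y ∈ N₂ := N₂.add_mem he2 hg2
  have hy3 : y - 1 ∈ N₃ := by
    rw [show y - 1 = e + (g - 1) by ring]; exact N₃.add_mem he3 hg3
  have hnot : ∀ {N : Ideal A}, N.IsMaximal → ∀ {z : A}, z - 1 ∈ N → z ∉ N := fun {N} hN z hz hz' =>
    hN.ne_top ((Ideal.eq_top_iff_one N).2 (by simpa using N.sub_mem hz' hz))
  set V : Submodule R Q := Submodule.span R {(x : Q), (y : Q), algebraMap R Q m}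
  have hxV : (x : Q) ∈ V := Submodule.subset_span (by simp)
  have hyV : (y : Q) ∈ V := Submodule.subset_span (by simp)
  have hmV : algebraMap R Q m ∈ V := Submodule.subset_span (by simp)
  have hmu : IsUnit (algebraMap R Q m) := IsLocalization.map_units Q ⟨m, hreg⟩
  have hVfg : V.FG := Submodule.fg_span (by simp)
  have hV := h.one_mem_mul_div hVfg hmV hmu
  have hVmem : ∀ v ∈ V, ∃ α β γ : R, v = ((algebraMap R A α * x + algebraMap R A β * y +
      algebraMap R A (γ * m) : A) : Q) := by
    intro v hv
    obtain ⟨α, β, γ, rfl⟩ := Submodule.mem_span_triple.1 hv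
    refine ⟨α, β, γ, ?_⟩
    simp [Algebra.smul_def]
  have hγ : ∀ {N : Ideal A}, N.IsMaximal → ∀ γ : R, algebraMap R A (γ * m) ∈ N := fun hN γ =>
    (hmem hN).2 (Ideal.mul_mem_left _ _ hm)
  -- Over 𝔽₂ the vector α(1,1,0) + β(1,0,1) always has a zero coordinate: the second if α = 0, the
  -- third if β = 0, the first if α = β = 1.
  have hVnot : ∀ v : A, (v : Q) ∈ V → v ∈ N₁ ∨ v ∈ N₂ ∨ v ∈ N₃ := by
    intro v hv
    obtain ⟨α, β, γ, hv'⟩ := hVmem v hv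
    replace hv' := Subtype.ext hv'
    rcases hk α with hα | hα
    · right; left
      rw [hv']
      exact N₂.add_mem (N₂.add_mem (N₂.mul_mem_right _ ((hmem h₂).2 hα)) (N₂.mul_mem_left _ hy2))
        (hγ h₂ _)
    rcases hk β with hβ | hβ
    · right; right
      rw [hv']
      exact N₃.add_mem (N₃.add_mem (N₃.mul_mem_left _ hx3) (N₃.mul_mem_right _ ((hmem h₃).2 hβ)))
        (hγ h₃ _)
    · left
      have h2 : (2 : R) ∈ maximalIdeal R := by
        rcases hk (-1) with h | h
        · exact absurd ((maximalIdeal R).neg_mem h) (by simp)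
        · simpa [one_add_one_eq_two] using (maximalIdeal R).neg_mem h
      have hαβ : algebraMap R A (α + β) ∈ N₁ := (hmem h₁).2 (by
        rw [show α + β = (α - 1) + (β - 1) + 2 by ring]
        exact Ideal.add_mem _ (Ideal.add_mem _ hα hβ) h2)
      have : v = algebraMap R A (α + β) + algebraMap R A α * (x - 1) + algebraMap R A β * (y - 1) +
          algebraMap R A (γ * m) := by
        rw [hv', map_add]; ring
      rw [this]
      exact N₁.add_mem (N₁.add_mem (N₁.add_mem hαβ (N₁.mul_mem_left _ hx1))
        (N₁.mul_mem_left _ hy1)) (hγ h₁ _)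
  have hE : ∀ w ∈ multiplierRing V, ∃ u : A, (u : Q) = w := fun w hw =>
    ⟨⟨w, isIntegral_of_mem_multiplierRing hVfg hmV hmu hw⟩, rfl⟩
  -- Multipliers of V have a constant residue. Since ux vanishes at N₃ it is α times x modulo all
  -- three ideals, since uy vanishes at N₂ it is β' times y, and comparison at N₁ gives α = β'.
  have hEα : ∀ u : A, (u : Q) ∈ multiplierRing V → ∃ α : R, u - algebraMap R A α ∈ N₁ ∧
      u - algebraMap R A α ∈ N₂ ∧ u - algebraMap R A α ∈ N₃ := by
    intro u hu
    obtain ⟨α, β, γ, h1⟩ := hVmem _ (hu x hxV)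
    obtain ⟨α', β', γ', h2⟩ := hVmem _ (hu y hyV)
    replace h1 : u * x = _ := Subtype.ext h1
    replace h2 : u * y = _ := Subtype.ext h2
    have hβ : β ∈ maximalIdeal R := by
      rw [← hmem h₃, show algebraMap R A β = (u - algebraMap R A α) * x - algebraMap R A β * (y - 1)
        - algebraMap R A (γ * m) by linear_combination -h1]
      exact N₃.sub_mem (N₃.sub_mem (N₃.mul_mem_left _ hx3) (N₃.mul_mem_left _ hy3)) (hγ h₃ _)
    have hα' : α' ∈ maximalIdeal R := by
      rw [← hmem h₂, show algebraMap R A α' = (u - algebraMap R A β') * y -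
        algebraMap R A α' * (x - 1) - algebraMap R A (γ' * m) by linear_combination -h2]
      exact N₂.sub_mem (N₂.sub_mem (N₂.mul_mem_left _ hy2) (N₂.mul_mem_left _ hx2)) (hγ h₂ _)
    have key1 : ∀ {N : Ideal A}, N.IsMaximal → x - 1 ∈ N → u - algebraMap R A α ∈ N := by
      intro N hN hxN
      rw [show u - algebraMap R A α = algebraMap R A β * y + algebraMap R A (γ * m) -
        (u - algebraMap R A α) * (x - 1) by linear_combination h1]
      exact N.sub_mem (N.add_mem (N.mul_mem_right _ ((hmem hN).2 hβ)) (hγ hN _))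
        (N.mul_mem_left _ hxN)
    have key2 : ∀ {N : Ideal A}, N.IsMaximal → y - 1 ∈ N → u - algebraMap R A β' ∈ N := by
      intro N hN hyN
      rw [show u - algebraMap R A β' = algebraMap R A α' * x + algebraMap R A (γ' * m) -
        (u - algebraMap R A β') * (y - 1) by linear_combination h2]
      exact N.sub_mem (N.add_mem (N.mul_mem_right _ ((hmem hN).2 hα')) (hγ hN _))
        (N.mul_mem_left _ hyN)
    have hαβ : β' - α ∈ maximalIdeal R := by
      rw [← hmem h₁, map_sub, show algebraMap R A β' - algebraMap R A α =
        (u - algebraMap R A α) - (u - algebraMap R A β') by ring]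
      exact N₁.sub_mem (key1 h₁ hx1) (key2 h₁ hy1)
    refine ⟨α, key1 h₁ hx1, key1 h₂ hx2, ?_⟩
    rw [show u - algebraMap R A α = (u - algebraMap R A β') + algebraMap R A (β' - α) by
      rw [map_sub]; ring]
    exact N₃.add_mem (key2 h₃ hy3) ((hmem h₃).2 hαβ)
  have key : ∀ t ∈ V * (V / (V * V)), ∃ u : A, (u : Q) = t ∧ u ∈ N₁ ∧ u ∈ N₂ ∧ u ∈ N₃ := by
    intro t ht
    induction ht using Submodule.mul_induction_on' with
    | mem_mul_mem a ha b hb =>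
      obtain ⟨u, hu⟩ := hE _ (mul_mem_multiplierRing ha hb)
      obtain ⟨α, hα1, hα2, hα3⟩ := hEα u (hu ▸ mul_mem_multiplierRing ha hb)
      obtain ⟨αa, βa, γa, ha'⟩ := hVmem a ha
      obtain ⟨a', rfl⟩ : ∃ a' : A, (a' : Q) = a := ⟨_, ha'.symm⟩
      -- If a vanishes at N and v ∈ V does not, then (ab)v = a(vb) with vb integral forces ab to
      -- vanish at N, so its constant residue is zero.
      have hα : ∀ {N : Ideal A}, N.IsMaximal → u - algebraMap R A α ∈ N → ∀ v : A, (v : Q) ∈ V →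
          v ∉ N → a' ∈ N → α ∈ maximalIdeal R := by
        intro N hN hαN v hv hvN ha'N
        obtain ⟨w, hw⟩ := hE _ (mul_mem_multiplierRing hv hb)
        have h1 : u * v = a' * w := Subtype.ext (by
          simp only [MulMemClass.coe_mul, hu, hw]; ring)
        have h2 : u ∈ N := (hN.isPrime.mem_or_mem (h1 ▸ N.mul_mem_right w ha'N :
          u * v ∈ N)).resolve_right hvN
        rw [← hmem hN, ← sub_sub_cancel u (algebraMap R A α)]
        exact N.sub_mem h2 hαN
      have hαM : α ∈ maximalIdeal R := by
        rcases hVnot a' ha with h | h | h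
        · exact hα h₁ hα1 x hxV (hnot h₁ hx1) h
        · exact hα h₂ hα2 x hxV (hnot h₂ hx2) h
        · exact hα h₃ hα3 y hyV (hnot h₃ hy3) h
      refine ⟨u, hu, ?_, ?_, ?_⟩
      · simpa using N₁.add_mem hα1 ((hmem h₁).2 hαM)
      · simpa using N₂.add_mem hα2 ((hmem h₂).2 hαM)
      · simpa using N₃.add_mem hα3 ((hmem h₃).2 hαM)
    | add t _ t' _ ht ht' =>
      obtain ⟨u, hu, hu1, hu2, hu3⟩ := ht
      obtain ⟨v, hv, hv1, hv2, hv3⟩ := ht'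
      exact ⟨u + v, by rw [← hu, ← hv]; rfl, N₁.add_mem hu1 hv1, N₂.add_mem hu2 hv2,
        N₃.add_mem hu3 hv3⟩
  obtain ⟨u, hu, hu1, -, -⟩ := key 1 hV
  have : u = 1 := Subtype.ext hu
  exact h₁.ne_top ((Ideal.eq_top_iff_one _).2 (this ▸ hu1))

/-! ### Integrality of the tower -/

theorem Subalgebra.exists_mul_pow_mem_span [IsLocalRing R] [Ring.KrullDimLE 1 R]
    (hA : A ≤ integralClosure R Q) {m : R} (hreg : m ∈ nonZeroDivisors R)
    {N : Ideal A} (hN : N.IsMaximal) {d : A} (hd : d ∈ N) :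
    ∃ t ∉ N, ∃ j : ℕ, t * d ^ j ∈ Ideal.span {algebraMap R A m} := by
  by_contra! hc
  -- A prime containing m is maximal; if it also misses A ∖ N it equals N, and so contains d.
  obtain ⟨P, hP, hmP, hdisj⟩ := Ideal.exists_le_prime_disjoint (Ideal.span {algebraMap R A m})
    (N.primeCompl ⊔ Submonoid.powers d) (Set.disjoint_left.2 fun x hx hx' => by
      obtain ⟨t, ht, z, ⟨j, rfl⟩, rfl⟩ := Submonoid.mem_sup.1 hx'
      exact hc t ht j hx)
  have hPmax := Subalgebra.isMaximal_of_isPrime hA hreg hP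
    (hmP (Ideal.mem_span_singleton_self _))
  rw [Set.disjoint_left] at hdisj
  have hPN : P ≤ N := fun x hx => by
    by_contra hxN
    exact hdisj hx (Submonoid.mem_sup_left (show x ∈ N.primeCompl from hxN))
  have : P = N := hPmax.eq_of_le hN.ne_top hPN
  exact hdisj (this ▸ hd : d ∈ P) (Submonoid.mem_sup_right (Submonoid.mem_powers d))

/-- For V = (1, q) stability yields 1 = c + qd with c, d, qc, qd integral. If q is not integral, a
maximal ideal N over the denominator ideal of q contains c and d but not qd. A bound on the
denominators of all powers of q, here m, contradicts this. With W = Jac Rᵢ the lemma carries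
integrality up the tower. -/
theorem IsFinitelyStableRing.isIntegral_of_mul_mem [IsFractionRing R Q] [IsLocalRing R]
    [Ring.KrullDimLE 1 R] (h : IsFinitelyStableRing R) {m : R} (hm : m ∈ maximalIdeal R)
    (hreg : m ∈ nonZeroDivisors R) {W : Submodule R Q}
    (hW : ∀ w ∈ W, IsIntegral R w) (hmW : algebraMap R Q m ∈ W) {q : Q}
    (hq : ∀ w ∈ W, q * w ∈ W) : IsIntegral R q := by
  set A := integralClosure R Q with hAdef
  set V : Submodule R Q := Submodule.span R {1, q}
  have h1V : (1 : Q) ∈ V := Submodule.subset_span (by simp)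
  have hqV : q ∈ V := Submodule.subset_span (by simp)
  have hVfg : V.FG := Submodule.fg_span (by simp)
  have hV := h.one_mem_mul_div hVfg h1V isUnit_one
  have hE : ∀ v ∈ V, ∀ c ∈ V / (V * V), v * c ∈ A := fun v hv c hc =>
    isIntegral_of_mem_multiplierRing hVfg h1V isUnit_one (mul_mem_multiplierRing hv hc)
  obtain ⟨c, hc, d, hd, hcd⟩ : ∃ c ∈ V / (V * V), ∃ d ∈ V / (V * V), c + q * d = 1 := by
    rw [show V = Submodule.span R {1} ⊔ Submodule.span R {q} from Submodule.span_insert _ _,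
      Submodule.sup_mul, Submodule.mem_sup] at hV
    obtain ⟨c, hc, y, hy, hcy⟩ := hV
    obtain ⟨c', hc', rfl⟩ := Submodule.mem_span_singleton_mul.1 hc
    obtain ⟨d, hd, rfl⟩ := Submodule.mem_span_singleton_mul.1 hy
    rw [← show V = Submodule.span R {1} ⊔ Submodule.span R {q} from Submodule.span_insert _ _]
      at hc' hd
    exact ⟨c', hc', d, hd, by rw [← hcy, one_mul]⟩
  have hcA : c ∈ A := by simpa using hE 1 h1V c hc
  have hdA : d ∈ A := by simpa using hE 1 h1V d hd
  have hqcA : q * c ∈ A := hE q hqV c hc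
  have hqdA : q * d ∈ A := hE q hqV d hd
  let D : Ideal A :=
    { carrier := {t | q * t ∈ A}
      zero_mem' := by simp
      add_mem' := fun {a b} ha hb => by
        simp only [Set.mem_ofPred_eq, AddMemClass.coe_add, mul_add]
        exact A.add_mem ha hb
      smul_mem' := fun a b hb => by
        simp only [Set.mem_ofPred_eq, smul_eq_mul, MulMemClass.coe_mul, mul_left_comm q]
        exact A.mul_mem a.2 hb }
  by_contra hqA
  have hD : D ≠ ⊤ := fun hD => hqA (by
    have h1 : (1 : A) ∈ D := hD ▸ Submodule.mem_top
    simpa [D, hAdef, mem_integralClosure_iff] using h1)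
  obtain ⟨N, hN, hDN⟩ := Ideal.exists_le_maximal D hD
  have hdN : (⟨d, hdA⟩ : A) ∈ N := hDN hqdA
  have hqdN : (⟨q * d, hqdA⟩ : A) ∉ N := fun hqdN => by
    have h1 := N.add_mem (hDN hqcA : (⟨c, hcA⟩ : A) ∈ N) hqdN
    rw [show (⟨c, hcA⟩ + ⟨q * d, hqdA⟩ : A) = 1 from Subtype.ext hcd] at h1
    exact hN.ne_top ((Ideal.eq_top_iff_one _).2 h1)
  obtain ⟨t, ht, j, htj⟩ := Subalgebra.exists_mul_pow_mem_span le_rfl hreg hN hdN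
  obtain ⟨s, hs⟩ := Ideal.mem_span_singleton.1 htj
  have hpow : ∀ n, q ^ n * algebraMap R Q m ∈ W := fun n => by
    induction n with
    | zero => simpa
    | succ n ih => rw [pow_succ', mul_assoc]; exact hq _ ih
  have hs' : (t * d ^ j : Q) = algebraMap R Q m * s := congrArg Subtype.val hs
  -- Squaring produces m²: one factor makes q^(2j) integral, the other puts the product into N.
  have h1 : (t ^ 2 * (⟨q * d, hqdA⟩ : A) ^ (2 * j)) = algebraMap R A m *
      (s ^ 2 * ⟨q ^ (2 * j) * algebraMap R Q m, hW _ (hpow _)⟩) := Subtype.ext (by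
    simp only [MulMemClass.coe_mul, SubmonoidClass.coe_pow, Subalgebra.coe_algebraMap]
    rw [mul_pow, show (t : Q) ^ 2 * (q ^ (2 * j) * d ^ (2 * j)) = q ^ (2 * j) * (t * d ^ j) ^ 2 by
      ring, hs']
    ring)
  have h2 : t ^ 2 * (⟨q * d, hqdA⟩ : A) ^ (2 * j) ∈ N := by
    rw [h1]
    exact N.mul_mem_right _ ((Subalgebra.algebraMap_mem_maximal_iff le_rfl hN).2 hm)
  rcases hN.isPrime.mem_or_mem h2 with h | h
  · exact ht (hN.isPrime.mem_of_pow_mem _ h)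
  · exact hqdN (hN.isPrime.mem_of_pow_mem _ h)

theorem mem_jacobsonRadicalIn_iff {A : Subalgebra R Q} {q : Q} :
    q ∈ jacobsonRadicalIn A ↔ ∃ a ∈ Ideal.jacobson (⊥ : Ideal A), (a : Q) = q := Iff.rfl

theorem IsFinitelyStableRing.jacobsonTower_le [IsFractionRing R Q] [IsLocalRing R]
    [Ring.KrullDimLE 1 R] (h : IsFinitelyStableRing R) {m : R} (hm : m ∈ maximalIdeal R)
    (hreg : m ∈ nonZeroDivisors R) (i : ℕ) : jacobsonTower R Q i ≤ integralClosure R Q := by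
  induction i with
  | zero => exact bot_le
  | succ i ih =>
    refine fun q hq => h.isIntegral_of_mul_mem hm hreg
      (W := jacobsonRadicalIn (jacobsonTower R Q i)) ?_ ?_ hq
    · rintro _ ⟨a, -, rfl⟩
      exact ih a.2
    · exact ⟨algebraMap R _ m, Ideal.mem_jacobson_bot_iff_forall.2 fun N hN =>
        (Subalgebra.algebraMap_mem_maximal_iff ih hN).2 hm, rfl⟩

theorem IsFinitelyStableRing.isQuadraticExtension_jacobsonTowerUnion [IsFractionRing R Q]
    [IsLocalRing R] [Ring.KrullDimLE 1 R] (h : IsFinitelyStableRing R) {m : R}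
    (hm : m ∈ maximalIdeal R) (hreg : m ∈ nonZeroDivisors R) :
    IsQuadraticExtension R (jacobsonTowerUnion R Q) :=
  h.isQuadraticExtension_integralClosure.of_le (iSup_le (h.jacobsonTower_le hm hreg))

end Overrings

/-! ### Invertible ideals and a criterion for Dedekind rings -/

/-- An ideal is invertible if some multiple of it is generated by a nonzerodivisor. -/
def Ideal.IsInvertible {A : Type*} [CommRing A] (I : Ideal A) : Prop :=
  ∃ J : Ideal A, ∃ p ∈ nonZeroDivisors A, I * J = Ideal.span {p}

theorem Ideal.isInvertible_iff_isUnit {A : Type*} [CommRing A] (I : Ideal A) :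
    I.IsInvertible ↔ IsUnit (I : FractionalIdeal (nonZeroDivisors A) (FractionRing A)) := by
  constructor
  · rintro ⟨J, p, hp, h⟩
    have hu : IsUnit (FractionalIdeal.spanSingleton (nonZeroDivisors A)
        (algebraMap A (FractionRing A) p)) := by
      obtain ⟨b, hb⟩ := (IsLocalization.map_units (FractionRing A)
        (⟨p, hp⟩ : nonZeroDivisors A)).exists_right_inv
      refine IsUnit.of_mul_eq_one (FractionalIdeal.spanSingleton _ b) ?_
      rw [FractionalIdeal.spanSingleton_mul_spanSingleton, hb, FractionalIdeal.spanSingleton_one]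
    rw [← FractionalIdeal.coeIdeal_span_singleton, ← h, FractionalIdeal.coeIdeal_mul] at hu
    exact isUnit_of_mul_isUnit_left hu
  · intro h
    obtain ⟨J, hJ⟩ := h.exists_right_inv
    obtain ⟨a, ha, haJ⟩ := J.isFractional
    obtain ⟨J', hJ'⟩ := FractionalIdeal.le_one_iff_exists_coeIdeal.1
      (show FractionalIdeal.spanSingleton (nonZeroDivisors A)
        (algebraMap A (FractionRing A) a) * J ≤ 1 by
      rw [FractionalIdeal.spanSingleton_mul_le_iff]
      intro z hz
      obtain ⟨y, hy⟩ := haJ z hz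
      rw [Algebra.smul_def] at hy
      exact (FractionalIdeal.mem_one_iff _).2 ⟨y, hy⟩)
    refine ⟨J', a, ha, FractionalIdeal.coeIdeal_injective' (P := FractionRing A) le_rfl ?_⟩
    change ((I * J' : Ideal A) : FractionalIdeal (nonZeroDivisors A) (FractionRing A)) =
      (Ideal.span {a} : Ideal A)
    rw [FractionalIdeal.coeIdeal_mul, hJ', mul_left_comm, hJ, mul_one,
      FractionalIdeal.coeIdeal_span_singleton]

/-- A maximal ideal N over I must be one of the factors. If NK = pA, then p⁻¹IK is an ideal
containing the product of the remaining factors, and induction applies. -/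
theorem Ideal.isInvertible_of_multiset_prod_le {A : Type*} [CommRing A] (s : Multiset (Ideal A))
    (hs : ∀ N ∈ s, N.IsMaximal ∧ N.IsInvertible) {I : Ideal A} (h : s.prod ≤ I) :
    I.IsInvertible := by
  induction hc : s.card generalizing s I with
  | zero =>
    rw [Multiset.card_eq_zero.1 hc, Multiset.prod_zero, Ideal.one_eq_top, top_le_iff] at h
    exact ⟨⊤, 1, one_mem _, by simp [h]⟩
  | succ n ih =>
    by_cases hI : I = ⊤
    · exact ⟨⊤, 1, one_mem _, by simp [hI]⟩
    obtain ⟨N, hN, hIN⟩ := Ideal.exists_le_maximal I hI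
    obtain ⟨N', hN's, hN'⟩ := (hN.isPrime.multiset_prod_le).1 (h.trans hIN)
    obtain rfl : N' = N := (hs N' hN's).1.eq_of_le hN.ne_top hN'
    obtain ⟨t, rfl⟩ := Multiset.exists_cons_of_mem hN's
    obtain ⟨K, p, hp, hK⟩ := (hs N' hN's).2
    obtain ⟨J, hJ⟩ : ∃ J, I * K = Ideal.span {p} * J := by
      have h1 : I * K ≤ Ideal.span {p} := hK ▸ Ideal.mul_mono hIN le_rfl
      refine ⟨Submodule.comap (LinearMap.mulLeft A p) (I * K), le_antisymm ?_ ?_⟩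
      · rw [Ideal.le_span_singleton_mul_iff]
        intro z hz
        obtain ⟨y, rfl⟩ := Ideal.mem_span_singleton.1 (h1 hz)
        exact ⟨y, hz, rfl⟩
      · rw [Ideal.span_singleton_mul_le_iff]
        exact fun z hz => hz
    have h2 : t.prod ≤ J := by
      intro z hz
      have h3 : p * z ∈ Ideal.span {p} * J := by
        rw [← hJ]
        have h4 : p * z ∈ Ideal.span {p} * t.prod :=
          Ideal.mul_mem_mul (Ideal.mem_span_singleton_self p) hz
        rw [← hK, mul_right_comm] at h4
        rw [Multiset.prod_cons] at h
        exact Ideal.mul_mono h le_rfl h4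
      obtain ⟨y, hy, hyz⟩ := Ideal.mem_span_singleton_mul.1 h3
      rwa [← (mul_cancel_left_mem_nonZeroDivisors hp).1 hyz]
    obtain ⟨L, r, hr, hL⟩ := ih t (fun N hN => hs N (Multiset.mem_cons_of_mem hN)) h2
      (by simpa using hc)
    exact ⟨K * L, p * r, mul_mem hp hr, by
      rw [← mul_assoc, hJ, mul_assoc, hL, Ideal.span_singleton_mul_span_singleton]⟩

/-- The radical pA is N₁ or N₁N₂, so each maximal ideal is invertible, and pⁿ ∈ I says that I
contains a product of them. -/
theorem HasAtMostTwoMaximalIdeals.isDedekindRegular {A : Type*} [CommRing A] [Nontrivial A]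
    (h : HasAtMostTwoMaximalIdeals A) {p : A} (hp : p ∈ nonZeroDivisors A)
    (hJ : Ideal.jacobson ⊥ = Ideal.span {p})
    (hpow : ∀ I : Ideal A, IsRegularIdeal I → ∃ n, p ^ n ∈ I) : IsDedekindRegular A := by
  intro I hI
  rw [← Ideal.isInvertible_iff_isUnit]
  obtain ⟨n, hn⟩ := hpow I hI
  obtain ⟨N₁, N₂, h₁, h₂, hN⟩ := h.exists_pair
  by_cases h12 : N₁ = N₂
  · subst h12
    have hN₁ : N₁ = Ideal.span {p} := by
      rw [← hJ]
      ext x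
      rw [Ideal.mem_jacobson_bot_iff_forall]
      refine ⟨fun hx N hN' => ?_, fun hx => hx _ h₁⟩
      rcases hN N hN' with rfl | rfl <;> exact hx
    refine Ideal.isInvertible_of_multiset_prod_le (Multiset.replicate n N₁) (fun N hN => ?_) ?_
    · obtain rfl := Multiset.eq_of_mem_replicate hN
      exact ⟨h₁, ⊤, p, hp, by rw [Ideal.mul_top, hN₁]⟩
    · rw [Multiset.prod_replicate, hN₁, Ideal.span_singleton_pow,
        Ideal.span_singleton_le_iff_mem]
      exact hn
  · have hN₁ : N₁ * N₂ = Ideal.span {p} := by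
      rw [← hJ, Ideal.mul_eq_inf_of_coprime (h₁.coprime_of_ne h₂ h12)]
      ext x
      rw [Ideal.mem_jacobson_bot_iff_forall]
      refine ⟨fun hx N hN' => ?_, fun hx => ⟨hx _ h₁, hx _ h₂⟩⟩
      rcases hN N hN' with rfl | rfl
      exacts [hx.1, hx.2]
    refine Ideal.isInvertible_of_multiset_prod_le (n • {N₁, N₂}) (fun N hN => ?_) ?_
    · have hN' := Multiset.mem_of_mem_nsmul hN
      rw [Multiset.insert_eq_cons, Multiset.mem_cons, Multiset.mem_singleton] at hN'
      rcases hN' with rfl | rfl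
      · exact ⟨h₁, _, p, hp, hN₁⟩
      · exact ⟨h₂, N₁, p, hp, by rw [mul_comm, hN₁]⟩
    · rw [Multiset.prod_nsmul, Multiset.prod_pair, hN₁, Ideal.span_singleton_pow,
        Ideal.span_singleton_le_iff_mem]
      exact hn

/-! ### Jacobson radicals of quadratic extensions -/

section Overrings

variable {R Q : Type*} [CommRing R] [CommRing Q] [Algebra R Q] {A : Subalgebra R Q}

theorem exists_isMaximal_mem_of_not_isUnit {A : Type*} [CommRing A] {t : A} (h : ¬ IsUnit t) :
    ∃ N : Ideal A, N.IsMaximal ∧ t ∈ N := by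
  obtain ⟨N, hN, ht⟩ := exists_max_ideal_of_mem_nonunits h
  exact ⟨N, hN, ht⟩

/-- Reducing zw = az + bw + c modulo a maximal ideal gives c ∈ M. If a ∉ M, then a - w is a unit,
and multiplying zw by it leaves only w² and c; squares are handled first in the same way. -/
theorem IsQuadraticExtension.mul_mem_of_mem_jacobson [IsLocalRing R]
    (h : IsQuadraticExtension R A) {X : Ideal A} (hX : ∀ r ∈ maximalIdeal R, algebraMap R A r ∈ X)
    {z w : A} (hz : z ∈ Ideal.jacobson (⊥ : Ideal A)) (hw : w ∈ Ideal.jacobson (⊥ : Ideal A)) :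
    z * w ∈ X := by
  have hA := h.le_integralClosure
  rw [Ideal.mem_jacobson_bot_iff_forall] at hz hw
  rcases subsingleton_or_nontrivial A with hs | hs
  · rw [Subsingleton.elim (z * w) 0]; exact X.zero_mem
  obtain ⟨N, hN⟩ := Ideal.exists_maximal A
  have hunit : ∀ a : R, a ∉ maximalIdeal R → ∀ y : A, (∀ N : Ideal A, N.IsMaximal → y ∈ N) →
      IsUnit (algebraMap R A a - y) := by
    intro a ha y hy
    by_contra hu
    obtain ⟨P, hP, hP'⟩ := exists_isMaximal_mem_of_not_isUnit hu
    refine ha ((Subalgebra.algebraMap_mem_maximal_iff hA hP).1 ?_)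
    simpa using P.add_mem hP' (hy P hP)
  have hsq : ∀ y : A, (∀ N : Ideal A, N.IsMaximal → y ∈ N) → y * y ∈ X := by
    intro y hy
    obtain ⟨a, b, c, habc⟩ := h y y
    simp only [Algebra.smul_def] at habc
    have hc : algebraMap R A c ∈ X := hX c ((Subalgebra.algebraMap_mem_maximal_iff hA hN).1 (by
      rw [show algebraMap R A c = y * (y - algebraMap R A a - algebraMap R A b) by
        linear_combination -habc]
      exact N.mul_mem_right _ (hy N hN)))
    by_cases hab : a + b ∈ maximalIdeal R
    · rw [habc, ← add_mul, ← map_add]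
      exact X.add_mem (X.mul_mem_right _ (hX _ hab)) hc
    · have hu := hunit _ hab y hy
      have h1 : y * (algebraMap R A (a + b) - y) ∈ X := by
        rw [show y * (algebraMap R A (a + b) - y) = - algebraMap R A c by
          rw [map_add]; linear_combination -habc]
        exact X.neg_mem hc
      exact X.mul_mem_right _ ((X.mul_unit_mem_iff_mem hu).1 h1)
  have hmul : ∀ z w : A, (∀ N : Ideal A, N.IsMaximal → z ∈ N) →
      (∀ N : Ideal A, N.IsMaximal → w ∈ N) → ∀ a b c : R, c ∈ maximalIdeal R →
      z * w = algebraMap R A a * z + algebraMap R A b * w + algebraMap R A c →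
      a ∉ maximalIdeal R → z * w ∈ X := by
    intro z w hz hw a b c hc habc ha
    have hu := hunit a ha w hw
    rw [← X.mul_unit_mem_iff_mem hu, show z * w * (algebraMap R A a - w) =
      -(algebraMap R A b * (w * w)) - algebraMap R A c * w by linear_combination -w * habc]
    exact X.sub_mem (X.neg_mem (X.mul_mem_left _ (hsq w hw))) (X.mul_mem_right _ (hX _ hc))
  obtain ⟨a, b, c, habc⟩ := h z w
  simp only [Algebra.smul_def] at habc
  have hc : c ∈ maximalIdeal R := (Subalgebra.algebraMap_mem_maximal_iff hA hN).1 (by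
    rw [show algebraMap R A c = z * (w - algebraMap R A a) - algebraMap R A b * w by
      linear_combination -habc]
    exact N.sub_mem (N.mul_mem_right _ (hz N hN)) (N.mul_mem_left _ (hw N hN)))
  by_cases ha : a ∈ maximalIdeal R
  · by_cases hb : b ∈ maximalIdeal R
    · rw [habc]
      exact X.add_mem (X.add_mem (X.mul_mem_right _ (hX _ ha)) (X.mul_mem_right _ (hX _ hb)))
        (hX _ hc)
    · rw [mul_comm]
      exact hmul w z hw hz b a c hc (by linear_combination habc) hb
  · exact hmul z w hz hw a b c hc habc ha

/-- An element with residues (0, 1) is idempotent modulo X. Comparing a with z + a gives z(z + 2a -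
1) ∈ X, where the second factor has residues -1 and 1 and is a unit. -/
theorem IsQuadraticExtension.mem_of_mem_jacobson_of_ne [IsLocalRing R]
    (h : IsQuadraticExtension R A) {X : Ideal A} (hX : ∀ r ∈ maximalIdeal R, algebraMap R A r ∈ X)
    {N₁ N₂ : Ideal A} (h₁ : N₁.IsMaximal) (h₂ : N₂.IsMaximal) (h12 : N₁ ≠ N₂)
    (hN : ∀ N : Ideal A, N.IsMaximal → N = N₁ ∨ N = N₂) {z : A}
    (hz : z ∈ Ideal.jacobson (⊥ : Ideal A)) : z ∈ X := by
  have hA := h.le_integralClosure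
  rw [Ideal.mem_jacobson_bot_iff_forall] at hz
  obtain ⟨a, ha, d, hd, had⟩ := Submodule.mem_sup.1
    ((Ideal.eq_top_iff_one _).1 (h₁.coprime_of_ne h₂ h12))
  have hd' : a - 1 ∈ N₂ := by
    rw [← had, sub_add_cancel_left]; exact N₂.neg_mem hd
  have hidem : ∀ w ∈ N₁, w - 1 ∈ N₂ → w * w - w ∈ X := by
    intro w hw hw'
    obtain ⟨r, s, t, hrst⟩ := h w w
    simp only [Algebra.smul_def] at hrst
    have ht : t ∈ maximalIdeal R := (Subalgebra.algebraMap_mem_maximal_iff hA h₁).1 (by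
      rw [show algebraMap R A t = w * (w - algebraMap R A r - algebraMap R A s) by
        linear_combination -hrst]
      exact N₁.mul_mem_right _ hw)
    have hr : r + s - 1 ∈ maximalIdeal R := (Subalgebra.algebraMap_mem_maximal_iff hA h₂).1 (by
      rw [show algebraMap R A (r + s - 1) = (w - 1) * (w + 1 - algebraMap R A r - algebraMap R A s)
        - algebraMap R A t by
          simp only [map_sub, map_add, map_one]; linear_combination -hrst]
      exact N₂.sub_mem (N₂.mul_mem_right _ hw') ((Subalgebra.algebraMap_mem_maximal_iff hA h₂).2 ht))
    rw [show w * w - w = algebraMap R A (r + s - 1) * w + algebraMap R A t by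
      simp only [map_sub, map_add, map_one]; linear_combination hrst]
    exact X.add_mem (X.mul_mem_right _ (hX _ hr)) (hX _ ht)
  have h3 := hidem (z + a) (N₁.add_mem (hz _ h₁) ha) (by
    rw [add_sub_assoc]; exact N₂.add_mem (hz _ h₂) hd')
  have h4 : z * (z + 2 * a - 1) ∈ X := by
    rw [show z * (z + 2 * a - 1) = (z + a) * (z + a) - (z + a) - (a * a - a) by ring]
    exact X.sub_mem h3 (hidem a ha hd')
  refine (X.mul_unit_mem_iff_mem ?_).1 h4
  by_contra hu
  obtain ⟨N, hN', hu⟩ := exists_isMaximal_mem_of_not_isUnit hu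
  refine hN'.ne_top ((Ideal.eq_top_iff_one _).2 ?_)
  rcases hN N hN' with rfl | rfl
  · rw [show (1 : A) = z + 2 * a - (z + 2 * a - 1) by ring]
    exact N.sub_mem (N.add_mem (hz _ hN') (N.mul_mem_left _ ha)) hu
  · rw [show (1 : A) = (z + 2 * a - 1) - z - 2 * (a - 1) by ring]
    exact N.sub_mem (N.sub_mem hu (hz _ hN')) (N.mul_mem_left _ hd')

theorem mem_jacobsonRadicalIn_bot_iff [IsFractionRing R Q] [IsLocalRing R] {q : Q} :
    q ∈ jacobsonRadicalIn (⊥ : Subalgebra R Q) ↔ ∃ r ∈ maximalIdeal R, algebraMap R Q r = q := by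
  have : Nontrivial Q := (IsFractionRing.injective R Q).nontrivial
  rw [mem_jacobsonRadicalIn_iff]
  constructor
  · rintro ⟨⟨a, ha⟩, ha', rfl⟩
    obtain ⟨r, rfl⟩ := Algebra.mem_bot.1 ha
    obtain ⟨N, hN⟩ := Ideal.exists_maximal (⊥ : Subalgebra R Q)
    exact ⟨r, (Subalgebra.algebraMap_mem_maximal_iff bot_le hN).1
      (Ideal.mem_jacobson_bot_iff_forall.1 ha' N hN), rfl⟩
  · rintro ⟨r, hr, rfl⟩
    exact ⟨algebraMap R _ r, Ideal.mem_jacobson_bot_iff_forall.2 fun N hN =>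
      (Subalgebra.algebraMap_mem_maximal_iff bot_le hN).2 hr, rfl⟩

/-- The ideals a·(V : V²) of E(V), for a ∈ V, sum to the unit ideal. By
`HasAtMostTwoMaximalIdeals.exists_eq_top` one of them is already everything, so xb = 1 and z =
x(zb). -/
theorem exists_mul_eq_of_one_mem_mul_div [Nontrivial Q] {V : Submodule R Q}
    (h2 : HasAtMostTwoMaximalIdeals (multiplierRing V)) (hV : (1 : Q) ∈ V * (V / (V * V))) :
    ∃ x ∈ V, ∀ z ∈ V, ∃ t ∈ multiplierRing V, z = x * t := by
  let φ : V → Ideal (multiplierRing V) := fun a =>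
    { carrier := {t | ∃ b ∈ V / (V * V), (t : Q) = a * b}
      zero_mem' := ⟨0, Submodule.zero_mem _, by simp⟩
      add_mem' := by
        rintro s t ⟨b, hb, hs⟩ ⟨c, hc, ht⟩
        exact ⟨b + c, Submodule.add_mem _ hb hc, by
          rw [AddMemClass.coe_add, hs, ht, mul_add]⟩
      smul_mem' := by
        rintro s t ⟨b, hb, ht⟩
        refine ⟨s * b, mem_div_mul_iff.2 fun x hx y hy => ?_, ?_⟩
        · rw [mul_assoc]; exact s.2 _ (mem_div_mul_iff.1 hb x hx y hy)
        · rw [smul_eq_mul, MulMemClass.coe_mul, ht]; ring }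
  obtain ⟨⟨x, hx⟩, hφx⟩ := h2.exists_eq_top φ (by
    rintro ⟨a, ha⟩ ⟨a', ha'⟩ t ⟨b, hb, ht⟩
    have : t = ⟨a * b, mul_mem_multiplierRing ha hb⟩ +
        -⟨a' * b, mul_mem_multiplierRing ha' hb⟩ := Subtype.ext (by
      rw [ht]; simp [sub_eq_add_neg, add_mul])
    rw [this]
    exact Submodule.add_mem_sup ⟨b, hb, rfl⟩ (Submodule.neg_mem _ ⟨b, hb, rfl⟩)) (by
    intro N hN
    by_contra! hc
    have key : ∀ t ∈ V * (V / (V * V)), ∃ u ∈ N, (u : Q) = t := by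
      intro t ht
      induction ht using Submodule.mul_induction_on' with
      | mem_mul_mem a ha b hb =>
        exact ⟨⟨a * b, mul_mem_multiplierRing ha hb⟩, hc ⟨a, ha⟩ ⟨b, hb, rfl⟩, rfl⟩
      | add t _ t' _ h h' =>
        obtain ⟨u, hu, rfl⟩ := h
        obtain ⟨u', hu', rfl⟩ := h'
        exact ⟨u + u', N.add_mem hu hu', rfl⟩
    obtain ⟨u, hu, hu1⟩ := key 1 hV
    exact hN.ne_top ((Ideal.eq_top_iff_one _).2 ((Subtype.ext hu1 : u = 1) ▸ hu)))
  obtain ⟨b, hb, h1⟩ := hφx ▸ Submodule.mem_top (x := (1 : multiplierRing V))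
  refine ⟨x, hx, fun z hz => ⟨z * b, mul_mem_multiplierRing hz hb, ?_⟩⟩
  rw [mul_left_comm, ← h1]; simp

theorem IsStableIdeal.exists_maximalIdeal_generator [IsFractionRing R Q] [IsLocalRing R]
    (h : IsStableIdeal (maximalIdeal R)) (hreg : IsRegularIdeal (maximalIdeal R))
    (h2 : HasAtMostTwoMaximalIdeals (jacobsonTower R Q 1)) :
    ∃ x ∈ maximalIdeal R, ∀ r ∈ maximalIdeal R, ∃ t ∈ jacobsonTower R Q 1,
      algebraMap R Q r = algebraMap R Q x * t := by
  have : Nontrivial Q := (IsFractionRing.injective R Q).nontrivial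
  obtain ⟨x, hx, hx'⟩ := exists_mul_eq_of_one_mem_mul_div
    (V := jacobsonRadicalIn (⊥ : Subalgebra R Q)) h2
    (h.one_mem_mul_div hreg (one_mem _) (by
      intro v hv
      obtain ⟨r, hr, rfl⟩ := mem_jacobsonRadicalIn_bot_iff.1 hv
      exact ⟨r, hr, by simp⟩) (by
      intro r hr
      exact ⟨_, mem_jacobsonRadicalIn_bot_iff.2 ⟨r, hr, rfl⟩, by simp⟩))
  obtain ⟨x, hxM, rfl⟩ := mem_jacobsonRadicalIn_bot_iff.1 hx
  exact ⟨x, hxM, fun r hr => hx' _ (mem_jacobsonRadicalIn_bot_iff.2 ⟨r, hr, rfl⟩)⟩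

end Overrings

/-! ### R_∞ is the integral closure, and the return to stability -/

section Overrings

variable {R Q : Type*} [CommRing R] [CommRing Q] [Algebra R Q] {A : Subalgebra R Q}

theorem exists_pow_mul_eq_algebraMap [IsFractionRing R Q] [IsLocalRing R] [Ring.KrullDimLE 1 R]
    {m : R} (hm : m ∈ maximalIdeal R) (q : Q) :
    ∃ n, ∃ r : R, algebraMap R Q (m ^ n) * q = algebraMap R Q r := by
  obtain ⟨⟨a, s⟩, hs⟩ := IsLocalization.surj (nonZeroDivisors R) q
  obtain ⟨n, c, hc⟩ := exists_dvd_pow_of_krullDimLE_one hm s.2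
  refine ⟨n, c * a, ?_⟩
  rw [hc, map_mul, map_mul, ← hs]
  ring

theorem IsRegularIdeal.exists_pow_mem_of_mem_jacobson [IsFractionRing R Q] [IsLocalRing R]
    [Ring.KrullDimLE 1 R] (hA : A ≤ integralClosure R Q) {m : R} (hm : m ∈ maximalIdeal R)
    (hreg : m ∈ nonZeroDivisors R) {I : Ideal A} (hI : IsRegularIdeal I) {p : A}
    (hp : p ∈ Ideal.jacobson (⊥ : Ideal A)) : ∃ n, p ^ n ∈ I := by
  suffices h : p ∈ I.radical from h
  rw [Ideal.radical_eq_sInf, Ideal.mem_sInf]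
  rintro P ⟨hIP, hP⟩
  obtain ⟨y, hy, hy'⟩ := hI
  obtain ⟨z, hz⟩ := (Subalgebra.isUnit_of_mem_nonZeroDivisors hy').exists_right_inv
  obtain ⟨n, r, hr⟩ := exists_pow_mul_eq_algebraMap hm z
  have h1 : algebraMap R A m ^ n = y * algebraMap R A r := Subtype.ext (by
    simp only [SubmonoidClass.coe_pow, Subalgebra.coe_algebraMap, MulMemClass.coe_mul, ← hr]
    rw [mul_left_comm, hz, mul_one, map_pow])
  have h2 : algebraMap R A m ∈ P := hP.mem_of_pow_mem n (h1 ▸ P.mul_mem_right _ (hIP hy))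
  exact Ideal.mem_jacobson_bot_iff_forall.1 hp P (Subalgebra.isMaximal_of_isPrime hA hreg hP h2)

theorem Ideal.IsInvertible.mem_of_forall_mul_mem [IsFractionRing R Q] {I : Ideal A}
    (hI : I.IsInvertible) {q : Q} (hq : ∀ a ∈ I, ∃ b ∈ I, q * a = (b : Q)) : q ∈ A := by
  obtain ⟨K, p, hp, hK⟩ := hI
  have key : ∀ t ∈ I * K, ∃ u ∈ I * K, q * t = (u : Q) := by
    intro t ht
    induction ht using Submodule.mul_induction_on' with
    | mem_mul_mem a ha b hb =>
      obtain ⟨c, hc, hc'⟩ := hq a ha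
      exact ⟨c * b, Ideal.mul_mem_mul hc hb, by
        rw [MulMemClass.coe_mul, MulMemClass.coe_mul, ← mul_assoc, hc']⟩
    | add t _ t' _ h h' =>
      obtain ⟨u, hu, hu'⟩ := h
      obtain ⟨v, hv, hv'⟩ := h'
      exact ⟨u + v, add_mem hu hv, by
        rw [AddMemClass.coe_add, AddMemClass.coe_add, mul_add, hu', hv']⟩
  obtain ⟨u, hu, hu'⟩ := key p (hK ▸ Ideal.mem_span_singleton_self p)
  rw [hK] at hu
  obtain ⟨c, rfl⟩ := Ideal.mem_span_singleton.1 hu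
  have : q = c := (Subalgebra.isUnit_of_mem_nonZeroDivisors hp).mul_left_cancel (by
    rw [mul_comm, hu', MulMemClass.coe_mul])
  exact this ▸ c.2

/-- The t with qⁿt ∈ A for all n form an ideal stable under q, which is regular since q is almost
integral. An invertible ideal has no multipliers outside A. -/
theorem IsDedekindRegular.integralClosure_le [IsFractionRing R Q] (h : IsDedekindRegular A) :
    integralClosure R Q ≤ A := by
  intro q hq
  obtain ⟨r, hr, hrq⟩ := IsIntegral.isAlmostIntegral (R := R) hq
  let I : Ideal A :=
    { carrier := {t | ∀ n : ℕ, q ^ n * t ∈ A}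
      zero_mem' := fun n => by simp
      add_mem' := fun {a b} ha hb n => by
        rw [AddMemClass.coe_add, mul_add]
        exact A.add_mem (ha n) (hb n)
      smul_mem' := fun a b hb n => by
        rw [smul_eq_mul, MulMemClass.coe_mul, mul_left_comm]
        exact A.mul_mem a.2 (hb n) }
  have hI : IsRegularIdeal I := by
    refine ⟨algebraMap R A r, fun n => ?_, Subalgebra.mem_nonZeroDivisors_of_isUnit
      (IsLocalization.map_units Q ⟨r, hr⟩)⟩
    obtain ⟨s, hs⟩ := hrq n
    rw [Algebra.smul_def] at hs
    rw [Subalgebra.coe_algebraMap, mul_comm, ← hs]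
    exact A.algebraMap_mem s
  refine ((Ideal.isInvertible_iff_isUnit I).2 (h I hI)).mem_of_forall_mul_mem fun a ha => ?_
  have h1 : q * a ∈ A := by simpa using ha 1
  refine ⟨⟨q * a, h1⟩, fun n => ?_, rfl⟩
  have h2 := ha (n + 1)
  rwa [pow_succ, mul_assoc] at h2

/-- The generator is x, except possibly when R_∞ is local and x is, up to a unit, a product zw of
two elements of the radical; then w generates. -/
theorem exists_jacobson_jacobsonTowerUnion_eq_span [IsFractionRing R Q] [IsLocalRing R]
    (hQ : IsQuadraticExtension R (jacobsonTowerUnion R Q))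
    (h2 : HasAtMostTwoMaximalIdeals (jacobsonTowerUnion R Q)) {x m : R}
    (hx : x ∈ maximalIdeal R) (hm : m ∈ maximalIdeal R) (hreg : m ∈ nonZeroDivisors R)
    (hxM : ∀ r ∈ maximalIdeal R, ∃ t ∈ jacobsonTower R Q 1,
      algebraMap R Q r = algebraMap R Q x * t) :
    ∃ p ∈ nonZeroDivisors (jacobsonTowerUnion R Q),
      Ideal.jacobson (⊥ : Ideal (jacobsonTowerUnion R Q)) = Ideal.span {p} := by
  have : Nontrivial Q := (IsFractionRing.injective R Q).nontrivial
  set A := jacobsonTowerUnion R Q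
  have hA := hQ.le_integralClosure
  have hle : ∀ i, jacobsonTower R Q i ≤ A := le_iSup _
  have hmono : Monotone (jacobsonTower R Q) := monotone_nat_of_le_succ (jacobsonTower_le_succ R Q)
  have hxu : IsUnit (algebraMap R Q x) := by
    obtain ⟨t, -, ht⟩ := hxM m hm
    exact isUnit_of_mul_isUnit_left (ht ▸ IsLocalization.map_units Q ⟨m, hreg⟩)
  obtain ⟨y, hy⟩ := hxu.exists_left_inv
  set X : A := algebraMap R A x
  have hXnzd : X ∈ nonZeroDivisors A := Subalgebra.mem_nonZeroDivisors_of_isUnit hxu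
  have hMX : ∀ r ∈ maximalIdeal R, algebraMap R A r ∈ Ideal.span {X} := by
    intro r hr
    obtain ⟨t, ht, hrt⟩ := hxM r hr
    exact Ideal.mem_span_singleton.2 ⟨⟨t, hle 1 ht⟩, Subtype.ext hrt⟩
  have hXJ : X ∈ Ideal.jacobson (⊥ : Ideal A) := Ideal.mem_jacobson_bot_iff_forall.2 fun N hN =>
    (Subalgebra.algebraMap_mem_maximal_iff hA hN).2 hx
  have hXle : Ideal.span {X} ≤ Ideal.jacobson (⊥ : Ideal A) :=
    (Ideal.span_singleton_le_iff_mem _).2 hXJ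
  obtain ⟨N₁, N₂, h₁, h₂, hN⟩ := h2.exists_pair
  by_cases h12 : N₁ = N₂
  swap
  · exact ⟨X, hXnzd, le_antisymm
      (fun z hz => hQ.mem_of_mem_jacobson_of_ne hMX h₁ h₂ h12 hN hz) hXle⟩
  subst h12
  have hunit : ∀ t : A, t ∉ Ideal.jacobson (⊥ : Ideal A) → IsUnit t := by
    intro t ht
    by_contra hu
    obtain ⟨N, hN', htN⟩ := exists_isMaximal_mem_of_not_isUnit hu
    refine ht (Ideal.mem_jacobson_bot_iff_forall.2 fun N' hN'' => ?_)
    rcases hN N hN' with rfl | rfl <;> rcases hN N' hN'' with rfl | rfl <;> exact htN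
  by_cases hcase : ∃ z ∈ Ideal.jacobson (⊥ : Ideal A), ∃ w ∈ Ideal.jacobson (⊥ : Ideal A),
      ∃ t, IsUnit t ∧ z * w = X * t
  · obtain ⟨z, hz, w, hw, t, ht, hzw⟩ := hcase
    obtain ⟨s, hs⟩ := ht.exists_right_inv
    have hnzd : z * w ∈ nonZeroDivisors A := hzw ▸ mul_mem hXnzd ht.mem_nonZeroDivisors
    have hz' : z ∈ nonZeroDivisors A := (mul_mem_nonZeroDivisors.1 hnzd).1
    refine ⟨w, (mul_mem_nonZeroDivisors.1 hnzd).2, le_antisymm (fun v hv => ?_)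
      ((Ideal.span_singleton_le_iff_mem _).2 hw)⟩
    -- The product zv lies in xA = zwA, and z cancels.
    obtain ⟨u, hu⟩ := Ideal.mem_span_singleton.1 (hQ.mul_mem_of_mem_jacobson hMX hz hv)
    refine Ideal.mem_span_singleton.2 ⟨s * u, (mul_cancel_left_mem_nonZeroDivisors hz').1 ?_⟩
    linear_combination hu - X * u * hs - s * u * hzw
  · refine ⟨X, hXnzd, le_antisymm (fun z hz => ?_) hXle⟩
    -- The index i + 1 ensures R₁ ⊆ T, hence M ⊆ xT.
    obtain ⟨i, hi⟩ : ∃ i, (z : Q) ∈ jacobsonTower R Q (i + 1) := by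
      obtain ⟨i, hi⟩ := Set.mem_iUnion.1 ((coe_jacobsonTowerUnion R Q).subset z.2)
      exact ⟨i, jacobsonTower_le_succ R Q i hi⟩
    set T := jacobsonTower R Q (i + 1)
    have hTA : T ≤ A := hle _
    have hJT : ∀ v : T, Subalgebra.inclusion hTA v ∈ Ideal.jacobson (⊥ : Ideal A) ↔
      v ∈ Ideal.jacobson (⊥ : Ideal T) := Subalgebra.mem_jacobson_inclusion_iff hA hTA
    have hMT : ∀ r ∈ maximalIdeal R, algebraMap R T r ∈ Ideal.span {algebraMap R T x} := by
      intro r hr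
      obtain ⟨t, ht, hrt⟩ := hxM r hr
      exact Ideal.mem_span_singleton.2
        ⟨⟨t, hmono (Nat.le_add_left 1 i) ht⟩, Subtype.ext hrt⟩
    -- Here z/x maps Jac T into itself: zv = xt with t ∈ T, and t lies in the radical because the
    -- case of a unit has been excluded. So z/x appears one level higher.
    have hmem : y * z ∈ jacobsonTower R Q (i + 2) := by
      rintro _ ⟨v, hv, rfl⟩
      obtain ⟨t, ht⟩ := Ideal.mem_span_singleton.1 ((hQ.of_le hTA).mul_mem_of_mem_jacobson hMT
        ((hJT ⟨z, hi⟩).1 hz) hv)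
      have ht' : (z * v : Q) = algebraMap R Q x * t := congrArg Subtype.val ht
      have htJ : t ∈ Ideal.jacobson (⊥ : Ideal T) := by
        rw [← hJT]
        by_contra htJ
        exact hcase ⟨z, hz, _, (hJT v).2 hv, _, hunit _ htJ, Subtype.ext ht'⟩
      refine ⟨t, htJ, ?_⟩
      change (t : Q) = y * z * v
      rw [mul_assoc, ht', ← mul_assoc, hy, one_mul]
    refine Ideal.mem_span_singleton.2 ⟨⟨y * z, hle _ hmem⟩, Subtype.ext ?_⟩
    change (z : Q) = algebraMap R Q x * (y * z)
    rw [← mul_assoc, mul_comm (algebraMap R Q x), hy, one_mul]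

theorem jacobsonTowerUnion_eq_integralClosure [IsFractionRing R Q] [IsLocalRing R]
    [Ring.KrullDimLE 1 R] {m : R} (hm : m ∈ maximalIdeal R) (hreg : m ∈ nonZeroDivisors R)
    (hQ : IsQuadraticExtension R (jacobsonTowerUnion R Q))
    (hM : IsStableIdeal (maximalIdeal R))
    (h2 : HasAtMostTwoMaximalIdeals (integralClosure R Q)) :
    jacobsonTowerUnion R Q = integralClosure R Q ∧
      IsDedekindRegular (jacobsonTowerUnion R Q) := by
  have : Nontrivial Q := (IsFractionRing.injective R Q).nontrivial
  have hA := hQ.le_integralClosure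
  have h2A : HasAtMostTwoMaximalIdeals (jacobsonTowerUnion R Q) := h2.of_le le_rfl hA
  obtain ⟨x, hx, hxM⟩ := hM.exists_maximalIdeal_generator (Q := Q) ⟨m, hm, hreg⟩
    (h2A.of_le hA (le_iSup (jacobsonTower R Q) 1))
  obtain ⟨p, hp, hJ⟩ := exists_jacobson_jacobsonTowerUnion_eq_span hQ h2A hx hm hreg hxM
  have hD : IsDedekindRegular (jacobsonTowerUnion R Q) :=
    h2A.isDedekindRegular hp hJ fun I hI =>
      hI.exists_pow_mem_of_mem_jacobson hA hm hreg (hJ ▸ Ideal.mem_span_singleton_self p)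
  exact ⟨le_antisymm hA hD.integralClosure_le, hD⟩

/-- Once u ∈ I generates IA, elements x = us and y = ut of I satisfy xy = u(ax + by + cu) by the
quadratic relation for st. -/
theorem IsStableRing.of_isDedekindRegular [IsFractionRing R Q] [Nontrivial Q]
    (hQ : IsQuadraticExtension R A) (hD : IsDedekindRegular A)
    (h2 : HasAtMostTwoMaximalIdeals A) : IsStableRing R := by
  intro I hI
  have hreg : IsRegularIdeal (I.map (algebraMap R A)) := by
    obtain ⟨a, ha, ha'⟩ := hI
    exact ⟨algebraMap R A a, Ideal.mem_map_of_mem _ ha, Subalgebra.mem_nonZeroDivisors_of_isUnit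
      (IsLocalization.map_units Q ⟨a, ha'⟩)⟩
  obtain ⟨K, p, hp, hK⟩ := (Ideal.isInvertible_iff_isUnit _).2 (hD _ hreg)
  have hmul : ∀ a ∈ I, ∀ k ∈ K, ∃ t, algebraMap R A a * k = p * t := fun a ha k hk =>
    Ideal.mem_span_singleton.1 (hK ▸ Ideal.mul_mem_mul (Ideal.mem_map_of_mem _ ha) hk)
  -- `φ a` is the ideal p⁻¹aK of A. These sum to A as a runs over I, so a single u ∈ I has uK = pA.
  let φ : I → Ideal A := fun a =>
    { carrier := {t | ∃ k ∈ K, algebraMap R A a * k = p * t}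
      zero_mem' := ⟨0, K.zero_mem, by simp⟩
      add_mem' := by
        rintro s t ⟨k, hk, hs⟩ ⟨l, hl, ht⟩
        exact ⟨k + l, K.add_mem hk hl, by rw [mul_add, mul_add, hs, ht]⟩
      smul_mem' := by
        rintro s t ⟨k, hk, ht⟩
        exact ⟨s * k, K.mul_mem_left _ hk, by rw [smul_eq_mul, mul_left_comm, ht, mul_left_comm]⟩ }
  obtain ⟨⟨u, hu⟩, hφ⟩ := h2.exists_eq_top φ (by
    rintro ⟨a, ha⟩ ⟨b, hb⟩ t ⟨k, hk, ht⟩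
    obtain ⟨s, hs⟩ := hmul a ha k hk
    obtain ⟨s', hs'⟩ := hmul b hb k hk
    have : t = s + -s' := (mul_cancel_left_mem_nonZeroDivisors hp).1 (by
      rw [← ht, AddSubgroupClass.coe_sub, map_sub, mul_add, mul_neg, ← hs, ← hs']
      ring)
    rw [this]
    exact Submodule.add_mem_sup ⟨k, hk, hs⟩ (Submodule.neg_mem _ ⟨k, hk, hs'⟩)) (by
    intro N hN
    by_contra! hc
    have h1 : I.map (algebraMap R A) * K ≤ Ideal.span {p} * N := by
      rw [Ideal.map, Ideal.mul_le]
      intro r hr k hk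
      induction hr using Submodule.span_induction with
      | mem r hr =>
        obtain ⟨a, ha, rfl⟩ := hr
        obtain ⟨t, ht⟩ := hmul a ha k hk
        exact Ideal.mem_span_singleton_mul.2 ⟨t, hc ⟨a, ha⟩ ⟨k, hk, ht⟩, ht.symm⟩
      | zero => rw [zero_mul]; exact Ideal.zero_mem _
      | add r s _ _ h h' => rw [add_mul]; exact Ideal.add_mem _ h h'
      | smul a r _ h => rw [smul_mul_assoc]; exact Ideal.mul_mem_left _ _ h
    obtain ⟨t, ht, hpt⟩ := Ideal.mem_span_singleton_mul.1
      (h1 (hK ▸ Ideal.mem_span_singleton_self p))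
    have : t = 1 := (mul_cancel_left_mem_nonZeroDivisors hp).1 (by rw [hpt, mul_one])
    exact hN.ne_top ((Ideal.eq_top_iff_one _).2 (this ▸ ht)))
  obtain ⟨k, hk, huk⟩ := hφ ▸ Submodule.mem_top (x := (1 : A))
  simp only [mul_one] at huk
  have hinj : Function.Injective (algebraMap R A) := fun x y hxy =>
    IsFractionRing.injective R Q (congrArg Subtype.val hxy)
  have hpu := huk ▸ Subalgebra.isUnit_of_mem_nonZeroDivisors hp
  have huu : IsUnit (algebraMap R Q u) := isUnit_of_mul_isUnit_left hpu
  have hknzd : k ∈ nonZeroDivisors A := (mul_mem_nonZeroDivisors.1 (huk ▸ hp)).2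
  have hdiv : ∀ v ∈ I, ∃ t, algebraMap R A v = algebraMap R A u * t := by
    intro v hv
    obtain ⟨t, ht⟩ := hmul v hv k hk
    exact ⟨t, (mul_cancel_right_mem_nonZeroDivisors hknzd).1 (by rw [ht, ← huk]; ring)⟩
  refine isStableIdeal_of_mul_le
    (mem_nonZeroDivisors_of_isUnit_map (IsFractionRing.injective R Q) huu) hu ?_
  intro x hx y hy
  obtain ⟨s, hs⟩ := hdiv x hx
  obtain ⟨t, ht⟩ := hdiv y hy
  obtain ⟨a, b, c, habc⟩ := hQ s t
  simp only [Algebra.smul_def] at habc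
  refine ⟨a * x + b * y + c * u, I.add_mem (I.add_mem (I.mul_mem_left _ hx) (I.mul_mem_left _ hy))
    (I.mul_mem_left _ hu), hinj ?_⟩
  simp only [map_mul, map_add, hs, ht]
  linear_combination algebraMap R A u * algebraMap R A u * habc

end Overrings

/-! ### Passage to R/J -/

theorem IsStableIdeal.exists_pow_mem_mul_quadraticColon {R : Type*} [CommRing R] [IsLocalRing R]
    [Ring.KrullDimLE 1 R] {m : R} (hm : m ∈ maximalIdeal R) {I : Ideal R} (h : IsStableIdeal I)
    (hI : IsRegularIdeal I) : ∃ n, m ^ n ∈ I * quadraticColon (m ^ n) I := by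
  obtain ⟨s, hs, hs'⟩ := h.exists_mem_mul_quadraticColon hI
  obtain ⟨n, t, ht⟩ := exists_dvd_pow_of_krullDimLE_one hm hs
  have h1 : Ideal.span {t} * quadraticColon s I ≤ quadraticColon (m ^ n) I := by
    rw [Ideal.span_singleton_mul_le_iff]
    intro b hb x hx y hy
    obtain ⟨w, hw, hw'⟩ := hb x hx y hy
    exact ⟨w, hw, by rw [ht]; linear_combination t * hw'⟩
  refine ⟨n, Ideal.mul_mono le_rfl h1 ?_⟩
  rw [mul_left_comm, ht, mul_comm s]
  exact Ideal.mul_mem_mul (Ideal.mem_span_singleton_self t) hs'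

theorem IsRegularIdeal.exists_pow_mem {R : Type*} [CommRing R] [IsLocalRing R]
    [Ring.KrullDimLE 1 R] {m : R} (hm : m ∈ maximalIdeal R) {I : Ideal R}
    (hI : IsRegularIdeal I) : ∃ n, m ^ n ∈ I := by
  obtain ⟨s, hs, hs'⟩ := hI
  obtain ⟨n, hn⟩ := exists_dvd_pow_of_krullDimLE_one hm hs'
  exact ⟨n, I.mem_of_dvd hn hs⟩

theorem mem_iInf_span_pow_iff {R : Type*} [CommRing R] {m x : R} :
    x ∈ ⨅ i : ℕ, Ideal.span {m ^ i} ↔ ∀ i, m ^ i ∣ x := by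
  simp [Ideal.mem_span_singleton]

theorem exists_eq_pow_mul_of_mem_iInf_span_pow {R : Type*} [CommRing R] {m x : R}
    (hreg : m ∈ nonZeroDivisors R) (hx : x ∈ ⨅ i : ℕ, Ideal.span {m ^ i}) (n : ℕ) :
    ∃ y ∈ ⨅ i : ℕ, Ideal.span {m ^ i}, x = m ^ n * y := by
  rw [mem_iInf_span_pow_iff] at hx
  obtain ⟨y, hy⟩ := hx n
  refine ⟨y, mem_iInf_span_pow_iff.2 fun i => ?_, hy⟩
  obtain ⟨z, hz⟩ := hx (n + i)
  refine ⟨z, (mul_cancel_left_mem_nonZeroDivisors (pow_mem hreg n)).1 ?_⟩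
  rw [← hy, hz, pow_add, mul_assoc]

theorem mk_mem_nonZeroDivisors_quotient_iInf_span_pow {R : Type*} [CommRing R] {m : R}
    (hreg : m ∈ nonZeroDivisors R) :
    Ideal.Quotient.mk (⨅ i : ℕ, Ideal.span {m ^ i}) m ∈
      nonZeroDivisors (R ⧸ (⨅ i : ℕ, Ideal.span {m ^ i})) := by
  rw [mem_nonZeroDivisors_iff_right]
  intro z hz
  obtain ⟨z, rfl⟩ := Ideal.Quotient.mk_surjective z
  rw [← map_mul, Ideal.Quotient.eq_zero_iff_mem] at hz
  rw [Ideal.Quotient.eq_zero_iff_mem]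
  obtain ⟨y, hy, hzy⟩ := exists_eq_pow_mul_of_mem_iInf_span_pow hreg hz 1
  rwa [(mul_cancel_right_mem_nonZeroDivisors hreg).1 (hzy.trans (by rw [pow_one, mul_comm]))]

theorem map_quadraticColon_le {R S : Type*} [CommRing R] [CommRing S] {f : R →+* S}
    (hf : Function.Surjective f) (s : R) (I : Ideal R) :
    (quadraticColon s I).map f ≤ quadraticColon (f s) (I.map f) := by
  intro b hb x hx y hy
  obtain ⟨b, hb', rfl⟩ := (Ideal.mem_map_iff_of_surjective f hf).1 hb
  obtain ⟨x, hx', rfl⟩ := (Ideal.mem_map_iff_of_surjective f hf).1 hx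
  obtain ⟨y, hy', rfl⟩ := (Ideal.mem_map_iff_of_surjective f hf).1 hy
  obtain ⟨w, hw, hw'⟩ := hb' x hx' y hy'
  exact ⟨f w, Ideal.mem_map_of_mem f hw, by rw [← map_mul, ← map_mul, hw', map_mul]⟩

/-- Regular ideals of either ring contain a power of m, and those of R contain J. With s a power of
m, the criterion maps to R/J, and lifts back because all errors lie in J = mⁿJ. -/
theorem isStableRing_iff_isStableRing_quotient {R : Type*} [CommRing R] [IsLocalRing R]
    [Ring.KrullDimLE 1 R] {m : R} (hm : m ∈ maximalIdeal R) (hreg : m ∈ nonZeroDivisors R) :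
    IsStableRing R ↔ IsStableRing (R ⧸ (⨅ i : ℕ, Ideal.span {m ^ i})) := by
  have hreg' := mk_mem_nonZeroDivisors_quotient_iInf_span_pow hreg
  have hdiv := fun x hx => exists_eq_pow_mul_of_mem_iInf_span_pow (x := x) hreg hx
  have hJm : (⨅ i : ℕ, Ideal.span {m ^ i}) ≤ maximalIdeal R := fun x hx => by
    obtain ⟨y, hy, rfl⟩ := hdiv x hx 1
    rw [pow_one]
    exact Ideal.mul_mem_right _ _ hm
  -- From here on only J = mⁿJ, J ⊆ M and the regularity of m modulo J matter.
  generalize (⨅ i : ℕ, Ideal.span {m ^ i}) = J at hreg' hdiv hJm ⊢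
  set π := Ideal.Quotient.mk J
  have hπ : Function.Surjective π := Ideal.Quotient.mk_surjective
  have : Nontrivial (R ⧸ J) := Ideal.Quotient.nontrivial_iff.2
    (ne_top_of_le_ne_top (maximalIdeal.isMaximal R).ne_top hJm)
  have : IsLocalRing (R ⧸ J) := IsLocalRing.of_surjective' π hπ
  have : Ring.KrullDimLE 1 (R ⧸ J) := Ring.krullDimLE_iff.2
    ((ringKrullDim_quotient_le J).trans (Ring.krullDimLE_iff.1 ‹_›))
  have hm' : π m ∈ maximalIdeal (R ⧸ J) := by
    rw [mem_maximalIdeal, mem_nonunits_iff]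
    intro hu
    obtain ⟨c, hc⟩ := hu.exists_right_inv
    obtain ⟨c, rfl⟩ := hπ c
    rw [← sub_eq_zero, ← map_mul, ← map_one π, ← map_sub, Ideal.Quotient.eq_zero_iff_mem] at hc
    refine (maximalIdeal.isMaximal R).ne_top ((Ideal.eq_top_iff_one _).2 ?_)
    rw [← sub_sub_cancel (m * c) 1]
    exact Ideal.sub_mem _ (Ideal.mul_mem_right _ _ hm) (hJm hc)
  constructor
  · intro h I hI
    obtain ⟨k, hk⟩ := hI.exists_pow_mem hm'
    have hreg'' : IsRegularIdeal (I.comap π) := ⟨m ^ k, by rwa [Ideal.mem_comap, map_pow],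
      pow_mem hreg k⟩
    obtain ⟨n, hn⟩ := (h _ hreg'').exists_pow_mem_mul_quadraticColon hm hreg''
    refine isStableIdeal_of_mem_mul_quadraticColon (pow_mem hreg' n) ?_
    have h1 := Ideal.mem_map_of_mem π hn
    rw [Ideal.map_mul, map_pow] at h1
    have h2 := Ideal.mul_mono le_rfl (map_quadraticColon_le hπ (m ^ n) (I.comap π)) h1
    rwa [Ideal.map_comap_of_surjective π hπ, map_pow] at h2
  · intro h I hI
    obtain ⟨k, hk⟩ := hI.exists_pow_mem hm
    have hJI : J ≤ I := fun x hx => by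
      obtain ⟨y, -, rfl⟩ := hdiv x hx k
      exact I.mul_mem_right _ hk
    have hreg'' : IsRegularIdeal (I.map π) :=
      ⟨π m ^ k, by rw [← map_pow]; exact Ideal.mem_map_of_mem π hk, pow_mem hreg' k⟩
    obtain ⟨n, hn⟩ := (h _ hreg'').exists_pow_mem_mul_quadraticColon hm' hreg''
    have hJK : J ≤ quadraticColon (m ^ n) I := fun j hj x hx y hy => by
      obtain ⟨i, hi, rfl⟩ := hdiv j hj n
      exact ⟨i * x * y, I.mul_mem_left _ hy, by ring⟩
    have hJIK : J ≤ I * quadraticColon (m ^ n) I := fun j hj => by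
      obtain ⟨i, hi, rfl⟩ := hdiv j hj k
      exact Ideal.mul_mem_mul hk (hJK hi)
    -- The lifted relation fails by an element mⁿj with j ∈ J ⊆ I, and j is absorbed into w.
    have hle : quadraticColon (π m ^ n) (I.map π) ≤ (quadraticColon (m ^ n) I).map π := by
      intro b hb
      obtain ⟨b, rfl⟩ := hπ b
      refine Ideal.mem_map_of_mem π fun x hx y hy => ?_
      obtain ⟨w, hw, hw'⟩ := hb _ (Ideal.mem_map_of_mem π hx) _ (Ideal.mem_map_of_mem π hy)
      obtain ⟨w, hwI, rfl⟩ := (Ideal.mem_map_iff_of_surjective π hπ).1 hw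
      have h1 : b * x * y - m ^ n * w ∈ J := by
        rw [← Ideal.Quotient.eq_zero_iff_mem, map_sub, sub_eq_zero]
        simpa using hw'
      obtain ⟨j, hj, hj'⟩ := hdiv _ h1 n
      exact ⟨w + j, I.add_mem hwI (hJI hj), by linear_combination hj'⟩
    refine isStableIdeal_of_mem_mul_quadraticColon (pow_mem hreg n) ?_
    have h1 := Ideal.mul_mono le_rfl hle hn
    rw [← Ideal.map_mul, ← map_pow] at h1
    obtain ⟨t, ht, htm⟩ := (Ideal.mem_map_iff_of_surjective π hπ).1 h1
    rw [← sub_eq_zero, ← map_sub, Ideal.Quotient.eq_zero_iff_mem] at htm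
    simpa using Ideal.sub_mem _ ht (hJIK htm)

theorem theorem4p2 {R : Type*} [CommRing R] [IsLocalRing R] (hdim : ringKrullDim R = 1)
    (m : R) (hm : m ∈ IsLocalRing.maximalIdeal R) (hreg : m ∈ nonZeroDivisors R) :
    List.TFAE [
      IsStableRing R,
      IsFinitelyStableRing R ∧ IsStableIdeal (IsLocalRing.maximalIdeal R),
      IsQuadraticRing R ∧ HasAtMostTwoMaximalIdeals (integralClosure R (FractionRing R)),
      IsQuadraticExtension R (integralClosure R (FractionRing R)) ∧
        IsDedekindRegular (integralClosure R (FractionRing R)) ∧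
        HasAtMostTwoMaximalIdeals (integralClosure R (FractionRing R)),
      IsStableRing (R ⧸ (⨅ i : ℕ, Ideal.span {m ^ i}))] := by
  have hD : Ring.KrullDimLE 1 R := Ring.krullDimLE_iff.2 hdim.le
  have hM : IsRegularIdeal (maximalIdeal R) := ⟨m, hm, hreg⟩
  have : Nontrivial (FractionRing R) := (IsFractionRing.injective R (FractionRing R)).nontrivial
  tfae_have 1 → 2 := fun h => ⟨fun I _ hI => h I hI, h _ hM⟩
  tfae_have 2 → 3 := fun ⟨h, hs⟩ => ⟨⟨inferInstance,
    h.isQuadraticExtension_jacobsonTowerUnion hm hreg, hs, hM⟩,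
    h.hasAtMostTwoMaximalIdeals hm hreg⟩
  tfae_have 3 → 4 := by
    rintro ⟨⟨_, hQ, hs, _⟩, h2⟩
    obtain ⟨heq, hDed⟩ := jacobsonTowerUnion_eq_integralClosure hm hreg hQ hs h2
    rw [heq] at hQ hDed
    exact ⟨hQ, hDed, h2⟩
  tfae_have 4 → 1 := fun ⟨hQ, hDed, h2⟩ => IsStableRing.of_isDedekindRegular hQ hDed h2
  tfae_have 1 ↔ 5 := isStableRing_iff_isStableRing_quotient hm hreg
  tfae_finish
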